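/- Consider the autonomous system $$\frac{dT}{d\bar\tau}=3T(1-T)^2\sin^2\theta,\qquad \frac{d\theta}{d\bar\tau}=-T-\tfrac32(1-T)\sin 2\theta$$ on the closed cylinder $\bar{\mathbf S}=[0,1]\times(\mathbb R/2\pi\mathbb Z)$ with coordinates $(T,\theta)$, let $\mathbf S=\{0<T<1\}$ be its interior, and let $q=-1+3\sin^2\theta$ be the deceleration parameter. Put $$\mathrm M_\pm=(0,\pm\tfrac{\pi}{2}),\qquad \mathrm{dS}_+=(0,0),\qquad \mathrm{dS}_-=(0,\pi).$$ The $\omega$-limit set (respectively $\alpha$-limit set) of a solution is the set of its accumulation points as $\bar\tau\to+\infty$ (respectively $\bar\tau\to-\infty$). Then the following hold. 1. Through every point of $\bar{\mathbf S}$ there passes exactly one solution in $\bar{\mathbf S}$ defined for all $\bar\tau\in\mathbb R$; the sets $\{T=0\}$, $\mathbf S$ and $\{T=1\}$ are invariant. The map $\theta\mapsto\theta+\pi$ takes solutions to solutions, $\mathrm M_+$ to $\mathrm M_-$ and $\mathrm{dS}_+$ to $\mathrm{dS}_-$. 2. Along every solution in $\mathbf S$, $T$ is strictly increasing in $\bar\tau$.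 3. The fixed points in $\bar{\mathbf S}$ are exactly $\mathrm M_+,\mathrm M_-,\mathrm{dS}_+,\mathrm{dS}_-$. 4. $\mathrm M_\pm$ are hyperbolic sources: the linearization at each has eigenvalues $3,3$, and each is asymptotically stable in $\bar{\mathbf S}$ as $\bar\tau\to-\infty$. 5. $\mathrm{dS}_\pm$ are non-hyperbolic saddles: the linearization at each has eigenvalues $-3$ and $0$, with $-3$ belonging to the direction tangent to $T=0$. A solution in $\bar{\mathbf S}$ has $\omega$-limit set $\{\mathrm{dS}_+\}$ (respectively $\{\mathrm{dS}_-\}$) if and only if it lies on $T=0$ with $\cos\theta>0$ (respectively $\cos\theta<0$) at $\bar\tau=0$. A solution on $T=0$ with $\sin\theta>0$ (respectively $\sin\theta<0$) at $\bar\tau=0$ has $\alpha$-limit set $\{\mathrm M_+\}$ (respectively $\{\mathrm M_-\}$). 6. There is exactly one orbit in $\mathbf S$ with $\alpha$-limit set $\{\mathrm{dS}_+\}$ and exactly one orbit in $\mathbf S$ with $\alpha$-limit set $\{\mathrm{dS}_-\}$ (the attractor solutions); the second is the image of the first under $\theta\mapsto\theta+\pi$. Every other orbit in $\mathbf S$ has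 $\alpha$-limit set $\{\mathrm M_+\}$ or $\{\mathrm M_-\}$. 7. The circle $T=1$ is a periodic orbit, on which $d\theta/d\bar\tau=-1$, and it is the $\omega$-limit set of every orbit in $\mathbf S$. 8. Along every solution in $\mathbf S$ one has $-1\le q\le 2$, each of the values $q=-1$ and $q=2$ is attained at arbitrarily late times, and $q$ has no limit as $\bar\tau\to+\infty$ (asymptotic self-similarity is broken). -/

import Mathlib

open Filter Topology Set

namespace ScalarFieldFLRW

noncomputable section

/-- The infinite cylinder `ℝ × (ℝ / 2πℤ)` with coordinates `(T, θ)`. -/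
abbrev Cyl : Type := ℝ × Real.Angle

/-- The closed finite cylinder `0 ≤ T ≤ 1` (the extended state space). -/
def closedState : Set Cyl := {p | 0 ≤ p.1 ∧ p.1 ≤ 1}

/-- The physical state space `0 < T < 1`. -/
def state : Set Cyl := {p | 0 < p.1 ∧ p.1 < 1}

/-- The boundary circle `T = 0`. -/
def bottom : Set Cyl := {p | p.1 = 0}

/-- The boundary circle `T = 1`. -/
def top : Set Cyl := {p | p.1 = 1}

/-- The right-hand side of the system
`dT/dτ = 3 T (1 - T)² sin² θ`, `dθ/dτ = - T - (3/2) (1 - T) sin 2θ`,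
as the pair of its components in the coordinates `(T, θ)`. -/
def field (p : Cyl) : ℝ × ℝ :=
  (3 * p.1 * (1 - p.1) ^ 2 * p.2.sin ^ 2,
    -p.1 - 3 / 2 * (1 - p.1) * ((2 : ℕ) • p.2).sin)

/-- `c` is a solution in the closed cylinder, defined for all times. The derivative is computed in
a lift `(T, θ) : ℝ → ℝ × ℝ` of `c` (every continuous curve in the cylinder has one). -/
def IsSolution (c : ℝ → Cyl) : Prop :=
  (∀ τ, c τ ∈ closedState) ∧
  ∃ T θ : ℝ → ℝ, (∀ τ, c τ = (T τ, (θ τ : Real.Angle))) ∧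
    ∀ τ, HasDerivAt T (field (c τ)).1 τ ∧ HasDerivAt θ (field (c τ)).2 τ

/-- The set of accumulation points of a curve as `τ → +∞`. -/
def omegaSet (c : ℝ → Cyl) : Set Cyl := {p | MapClusterPt p atTop c}

/-- The set of accumulation points of a curve as `τ → -∞`. -/
def alphaSet (c : ℝ → Cyl) : Set Cyl := {p | MapClusterPt p atBot c}

/-- `O` is a periodic orbit: the range of a non-constant periodic solution. -/
def IsPeriodicOrbit (O : Set Cyl) : Prop :=
  ∃ c, IsSolution c ∧ range c = O ∧ O.Nontrivial ∧ ∃ P > 0, Function.Periodic c P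

/-- `O` is an orbit in the physical state space that originates from the point `p`. -/
def OriginatesFrom (p : Cyl) (O : Set Cyl) : Prop :=
  O ⊆ state ∧ ∃ c, IsSolution c ∧ range c = O ∧ alphaSet c = {p}

/-- Fixed points of the system on the closed cylinder. -/
def IsFixedPoint (p : Cyl) : Prop := p ∈ closedState ∧ field p = 0

/-- The linearization of the system at `p`, in the coordinates `(T, θ)` centred at `p`. -/
def linearization (p : Cyl) : (ℝ × ℝ) →L[ℝ] (ℝ × ℝ) :=
  fderiv ℝ (fun x : ℝ × ℝ => field (p.1 + x.1, p.2 + (x.2 : Real.Angle))) 0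

/-- The complex eigenvalues of the linearization at `p`, with algebraic multiplicity. -/
def eigenvalues (p : Cyl) : Multiset ℂ :=
  (linearization p : (ℝ × ℝ) →ₗ[ℝ] (ℝ × ℝ)).charpoly.aroots ℂ

/-- A fixed point is hyperbolic if no eigenvalue of the linearization lies on the imaginary axis. -/
def IsHyperbolic (p : Cyl) : Prop := IsFixedPoint p ∧ ∀ z ∈ eigenvalues p, z.re ≠ 0

/-- `p` is a source in the closed cylinder: it is asymptotically stable as `τ → -∞`. -/
def IsSource (p : Cyl) : Prop :=
  IsFixedPoint p ∧ ∀ V ∈ 𝓝 p, ∃ U ∈ 𝓝 p, ∀ c, IsSolution c → c 0 ∈ U →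
    (∀ τ ≤ 0, c τ ∈ V) ∧ Tendsto c atBot (𝓝 p)

/-- The massless scalar field point at `θ = π / 2`. -/
def MPlus : Cyl := (0, ((Real.pi / 2 : ℝ) : Real.Angle))

/-- The massless scalar field point at `θ = - π / 2`. -/
def MMinus : Cyl := (0, ((-Real.pi / 2 : ℝ) : Real.Angle))

/-- The de Sitter point at `θ = 0`. -/
def dSPlus : Cyl := (0, ((0 : ℝ) : Real.Angle))

/-- The de Sitter point at `θ = π`. -/
def dSMinus : Cyl := (0, (Real.pi : Real.Angle))

/-- The discrete symmetry `θ ↦ θ + π`. -/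
def halfTurn (p : Cyl) : Cyl := (p.1, p.2 + (Real.pi : Real.Angle))

/-- The deceleration parameter `q = -1 + 3 sin² θ`. -/
def decel (p : Cyl) : ℝ := -1 + 3 * p.2.sin ^ 2

end

end ScalarFieldFLRW

open ScalarFieldFLRW

/-!
`T` is nondecreasing, and the time that a solution spends in a band `m ≤ T ≤ M` with `0 < m` and
`M < 1` is bounded, because `sin θ cos θ - A T` decreases there at a definite rate when `A` is
large. Hence `T` tends to `1` in the future and to `0` in the past in the interior. Near `T = 1`
the angle rotates at a rate close to `-1`, which gives the ω-limit set and the oscillation of `q`.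

In the past, `sin θ - T / (3 (1 - T))` and its image under the half turn decide the fate of a
solution: once one of them is positive it stays positive and grows backwards in time, and the
solution tends to `MPlus` or `MMinus`. Otherwise `|sin θ| ≤ T / (3 (1 - T))` forever, and the
solution tends to a de Sitter point. Some solution is of the latter kind: the circle `T = 1/2` is
connected and cannot be split between the open basins of the two sources.

It is unique because in the variables `φ = (1 - T) cos θ / T` and `p = (1 - T) sin θ / T` the
solutions that leave `dSPlus` are graphs `p = P(φ)` over a neighbourhood of `φ = +∞` with
`-1/3 ≤ P < 0`, which solve `dp/dφ = -φ/p - 3 √(φ² + p²)`. In that range the right-hand side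
increases in `p` with slope at least `9 φ`, so two different graphs would separate exponentially.
-/

namespace ScalarFieldFLRW

section Flow

open scoped Manifold NNReal

variable {E : Type*} [NormedAddCommGroup E] [NormedSpace ℝ E] {v : E → E} {M : ℝ≥0}

theorem isMIntegralCurve_iff_hasDerivAt {γ : ℝ → E} :
    IsMIntegralCurve (I := 𝓘(ℝ, E)) γ v ↔ ∀ t, HasDerivAt γ (v (γ t)) t :=
  ⟨fun h t => hasDerivAt_iff_hasFDerivAt.2 (h t).hasFDerivAt,
    fun h t => (h t).hasFDerivAt.hasMFDerivAt⟩

theorem isMIntegralCurveOn_Ioo {γ : ℝ → E} {a b : ℝ}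
    (h : ∀ t ∈ Icc a b, HasDerivWithinAt γ (v (γ t)) (Icc a b) t) :
    IsMIntegralCurveOn (I := 𝓘(ℝ, E)) γ v (Ioo a b) := fun t ht =>
  hasMFDerivWithinAt_iff_hasFDerivWithinAt.2
    ((h t (Ioo_subset_Icc_self ht)).mono Ioo_subset_Icc_self).hasFDerivWithinAt

theorem eq_of_hasDerivAt [CompleteSpace E] (hv : ContDiff ℝ 1 v) {γ γ' : ℝ → E} {t₀ : ℝ}
    (hγ : ∀ t, HasDerivAt γ (v (γ t)) t) (hγ' : ∀ t, HasDerivAt γ' (v (γ' t)) t)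
    (h : γ t₀ = γ' t₀) : γ = γ' :=
  isMIntegralCurve_Ioo_eq_of_contMDiff_boundaryless (contMDiff_vectorSpace_iff_contDiff.2 hv)
    (isMIntegralCurve_iff_hasDerivAt.2 hγ) (isMIntegralCurve_iff_hasDerivAt.2 hγ') h

theorem exists_isPicardLindelof_of_norm_le [ProperSpace E] (hv : ContDiff ℝ 1 v)
    (hM : ∀ x, ‖v x‖ ≤ M) (x : E) (R : ℝ≥0) :
    ∃ K, IsPicardLindelof (fun _ => v) (⟨0, by simp⟩ : Icc (-(R : ℝ)) R) x (M * R + 1) 1 M K := by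
  obtain ⟨K, hK⟩ := (hv.locallyLipschitz.locallyLipschitzOn
    (s := Metric.closedBall x (M * R + 1 : ℝ≥0))).exists_lipschitzOnWith_of_compact
    (isCompact_closedBall x _)
  exact ⟨K, { lipschitzOnWith := fun _ _ => hK
              continuousOn := fun _ _ => continuousOn_const
              norm_le := fun _ _ y _ => hM y
              mul_max_le := by simp }⟩

theorem exists_flow_of_norm_le [ProperSpace E] (hv : ContDiff ℝ 1 v) (hM : ∀ x, ‖v x‖ ≤ M) :
    ∃ Φ : E → ℝ → E, (∀ x, Φ x 0 = x) ∧ (∀ x t, HasDerivAt (Φ x) (v (Φ x t)) t) ∧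
      ∀ t, Continuous fun x => Φ x t := by
  have hv' := contMDiff_vectorSpace_iff_contDiff (𝕜 := ℝ).2 hv
  have local_flow (x : E) (R : ℝ≥0) : ∃ α : E × ℝ → E,
      (∀ y ∈ Metric.closedBall x 1, α (y, 0) = y ∧
        IsMIntegralCurveOn (I := 𝓘(ℝ, E)) (fun t => α (y, t)) v (Ioo (-(R : ℝ)) R)) ∧
      ContinuousOn α (Metric.closedBall x 1 ×ˢ Icc (-(R : ℝ)) R) := by
    obtain ⟨K, hK⟩ := exists_isPicardLindelof_of_norm_le hv hM x R
    obtain ⟨α, hα, hcont⟩ := hK.exists_forall_mem_closedBall_eq_hasDerivWithinAt_continuousOn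
    exact ⟨α, fun y hy => ⟨(hα y hy).1, isMIntegralCurveOn_Ioo (hα y hy).2⟩, hcont⟩
  have global (x : E) : ∃ γ, γ 0 = x ∧ IsMIntegralCurve (I := 𝓘(ℝ, E)) γ v := by
    refine exists_isMIntegralCurve_of_isMIntegralCurveOn hv' one_pos (fun y => ?_) x
    obtain ⟨α, hα, -⟩ := local_flow y 1
    obtain ⟨h0, hα⟩ := hα y (Metric.mem_closedBall_self zero_le_one)
    exact ⟨_, h0, hα⟩
  choose Φ h0 hΦ using global
  refine ⟨Φ, h0, fun x => isMIntegralCurve_iff_hasDerivAt.1 (hΦ x), fun t => ?_⟩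
  refine continuous_iff_continuousAt.2 fun x => ?_
  obtain ⟨R, hR⟩ : ∃ R : ℝ≥0, |t| < R := ⟨‖t‖₊ + 1, by simp⟩
  obtain ⟨α, hα, hcont⟩ := local_flow x R
  have ht := abs_lt.1 hR
  have heq : ∀ y ∈ Metric.closedBall x 1, Φ y t = α (y, t) := fun y hy =>
    isMIntegralCurveOn_Ioo_eqOn_of_contMDiff_boundaryless (t₀ := 0)
      ⟨by linarith, by linarith⟩ hv' ((hΦ y).isMIntegralCurveOn _) (hα y hy).2
      ((h0 y).trans (hα y hy).1.symm) ht
  refine ContinuousOn.continuousAt ?_ (Metric.closedBall_mem_nhds x one_pos)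
  refine ContinuousOn.congr ?_ heq
  exact hcont.comp (by fun_prop) fun y hy => ⟨hy, ht.1.le, ht.2.le⟩

end Flow

section LinearEquation

variable {f a : ℝ → ℝ}

theorem eq_mul_exp_integral_of_hasDerivAt (ha : Continuous a)
    (hf : ∀ t, HasDerivAt f (a t * f t) t) (s t : ℝ) :
    f t = f s * Real.exp (∫ x in s..t, a x) := by
  have hA (t : ℝ) : HasDerivAt (fun t => ∫ x in s..t, a x) (a t) t :=
    (ha.integral_hasStrictDerivAt s t).hasDerivAt
  have hconst (t : ℝ) : HasDerivAt (fun t => f t * Real.exp (-∫ x in s..t, a x)) 0 t :=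
    ((hf t).fun_mul (hA t).fun_neg.exp).congr_deriv (by ring)
  have key := is_const_of_deriv_eq_zero (fun t => (hconst t).differentiableAt)
    (fun t => (hconst t).deriv) t s
  simp only [intervalIntegral.integral_same, neg_zero, Real.exp_zero, mul_one] at key
  rw [← key, mul_assoc, ← Real.exp_add, neg_add_cancel, Real.exp_zero, mul_one]

theorem pos_iff_of_hasDerivAt (ha : Continuous a) (hf : ∀ t, HasDerivAt f (a t * f t) t)
    (s t : ℝ) : 0 < f s ↔ 0 < f t := by
  rw [eq_mul_exp_integral_of_hasDerivAt ha hf s t, mul_pos_iff_of_pos_right (Real.exp_pos _)]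

end LinearEquation

section Lift

theorem hasDerivAt_prod_iff {E F : Type*} [NormedAddCommGroup E] [NormedSpace ℝ E]
    [NormedAddCommGroup F] [NormedSpace ℝ F] {f : ℝ → E × F} {f' : E × F} {t : ℝ} :
    HasDerivAt f f' t ↔
      HasDerivAt (fun t => (f t).1) f'.1 t ∧ HasDerivAt (fun t => (f t).2) f'.2 t :=
  ⟨fun h => ⟨(ContinuousLinearMap.fst ℝ E F).hasFDerivAt.comp_hasDerivAt t h,
      (ContinuousLinearMap.snd ℝ E F).hasFDerivAt.comp_hasDerivAt t h⟩,
    fun h => h.1.prodMk h.2⟩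

theorem field_eq (p : Cyl) : field p = (3 * p.1 * (1 - p.1) ^ 2 * p.2.sin ^ 2,
    -p.1 - 3 * (1 - p.1) * (p.2.sin * p.2.cos)) := by
  simp only [field, Real.Angle.sin_two_nsmul, nsmul_eq_mul, Prod.mk.injEq, true_and]
  push_cast
  ring

/-- The universal covering of the cylinder by the plane. -/
noncomputable def cover (x : ℝ × ℝ) : Cyl := (x.1, (x.2 : Real.Angle))

theorem continuous_cover : Continuous cover :=
  continuous_fst.prodMk (Real.Angle.continuous_coe.comp continuous_snd)

/-- The vector field of the system, lifted to the universal covering of the cylinder. -/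
noncomputable def liftField (x : ℝ × ℝ) : ℝ × ℝ :=
  (3 * x.1 * (1 - x.1) ^ 2 * Real.sin x.2 ^ 2,
    -x.1 - 3 * (1 - x.1) * (Real.sin x.2 * Real.cos x.2))

theorem field_cover (x : ℝ × ℝ) : field (cover x) = liftField x := by
  simp [field_eq, cover, liftField]

theorem contDiff_liftField {n : WithTop ℕ∞} : ContDiff ℝ n liftField := by
  unfold liftField
  fun_prop

theorem liftField_add_int_mul_pi (x : ℝ × ℝ) (n : ℤ) :
    liftField (x + (0, n * Real.pi)) = liftField x := by
  have hsign : (-1 : ℝ) ^ n * (-1) ^ n = 1 := by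
    rw [← zpow_add₀ (by norm_num), ← two_mul, (even_two_mul n).neg_one_zpow]
  simp only [liftField, Prod.fst_add, Prod.snd_add, add_zero, Real.sin_add_int_mul_pi,
    Real.cos_add_int_mul_pi, mul_mul_mul_comm _ (Real.sin x.2), sq, hsign, one_mul]

theorem isSolution_iff {c : ℝ → Cyl} :
    IsSolution c ↔ ∃ γ : ℝ → ℝ × ℝ, c = cover ∘ γ ∧ (∀ t, (γ t).1 ∈ Icc 0 1) ∧
      ∀ t, HasDerivAt γ (liftField (γ t)) t := by
  constructor
  · rintro ⟨hmem, T, θ, hc, hd⟩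
    refine ⟨fun t => (T t, θ t), funext hc, fun t => ?_, fun t => ?_⟩
    · simpa [hc, closedState] using hmem t
    · rw [← field_cover, cover, ← hc]
      exact (hd t).1.prodMk (hd t).2
  · rintro ⟨γ, rfl, hmem, hd⟩
    refine ⟨hmem, fun t => (γ t).1, fun t => (γ t).2, fun t => rfl, fun t => ?_⟩
    rw [Function.comp_apply, field_cover]
    exact hasDerivAt_prod_iff.1 (hd t)

namespace IsSolution

variable {c d : ℝ → Cyl}

theorem eq_of_eq (hc : IsSolution c) (hd : IsSolution d) {t₀ : ℝ} (h : c t₀ = d t₀) : c = d := by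
  obtain ⟨γ, rfl, -, hγ⟩ := isSolution_iff.1 hc
  obtain ⟨γ', rfl, -, hγ'⟩ := isSolution_iff.1 hd
  obtain ⟨n, hn⟩ := Real.Angle.angle_eq_iff_two_pi_dvd_sub.1 (congrArg Prod.snd h)
  have hγn (t : ℝ) : HasDerivAt (fun t => γ' t + (0, (2 * n : ℤ) * Real.pi))
      (liftField (γ' t + (0, (2 * n : ℤ) * Real.pi))) t := by
    rw [liftField_add_int_mul_pi]
    exact (hγ' t).add_const _
  have key : γ = fun t => γ' t + (0, (2 * n : ℤ) * Real.pi) := by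
    refine eq_of_hasDerivAt contDiff_liftField hγ hγn (t₀ := t₀) (Prod.ext ?_ ?_)
    · simpa [cover] using congrArg Prod.fst h
    · push_cast
      simp only [Prod.snd_add]
      linarith
  rw [key]
  funext t
  refine Prod.ext (by simp [cover]) (Real.Angle.angle_eq_iff_two_pi_dvd_sub.2 ⟨n, ?_⟩)
  push_cast
  simp only [Prod.snd_add]
  ring

theorem comp_add_const (hc : IsSolution c) (a : ℝ) : IsSolution fun t => c (t + a) := by
  obtain ⟨γ, rfl, hmem, hγ⟩ := isSolution_iff.1 hc
  exact isSolution_iff.2 ⟨fun t => γ (t + a), rfl, fun t => hmem _,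
    fun t => (hγ (t + a)).comp_add_const t a⟩

theorem range_eq_of_eq (hc : IsSolution c) (hd : IsSolution d) {s t : ℝ} (h : c s = d t) :
    range c = range d := by
  have key : c = fun r => d (r + (t - s)) :=
    hc.eq_of_eq (hd.comp_add_const _) (t₀ := s) (by simpa using h)
  rw [key]
  exact (Equiv.addRight (t - s)).surjective.range_comp d

theorem halfTurn (hc : IsSolution c) : IsSolution fun t => halfTurn (c t) := by
  obtain ⟨γ, rfl, hmem, hγ⟩ := isSolution_iff.1 hc
  refine isSolution_iff.2 ⟨fun t => γ t + (0, (1 : ℤ) * Real.pi), ?_, fun t => ?_, fun t => ?_⟩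
  · funext t
    simp [ScalarFieldFLRW.halfTurn, cover]
  · simpa using hmem t
  · rw [liftField_add_int_mul_pi]
    exact (hγ t).add_const _

theorem continuous (hc : IsSolution c) : Continuous c := by
  obtain ⟨γ, rfl, -, hγ⟩ := isSolution_iff.1 hc
  exact continuous_cover.comp (continuous_iff_continuousAt.2 fun t => (hγ t).continuousAt)

theorem continuous_fst (hc : IsSolution c) : Continuous fun t => (c t).1 :=
  hc.continuous.fst

theorem continuous_sin (hc : IsSolution c) : Continuous fun t => (c t).2.sin :=
  Real.Angle.continuous_sin.comp hc.continuous.snd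

theorem continuous_cos (hc : IsSolution c) : Continuous fun t => (c t).2.cos :=
  Real.Angle.continuous_cos.comp hc.continuous.snd

theorem hasDerivAt_fst (hc : IsSolution c) (t : ℝ) : HasDerivAt (fun t => (c t).1)
    (3 * (c t).1 * (1 - (c t).1) ^ 2 * (c t).2.sin ^ 2) t := by
  obtain ⟨γ, rfl, -, hγ⟩ := isSolution_iff.1 hc
  simpa [cover, liftField] using (hasDerivAt_prod_iff.1 (hγ t)).1

theorem hasDerivAt_sin (hc : IsSolution c) (t : ℝ) : HasDerivAt (fun t => (c t).2.sin)
    ((c t).2.cos * (-(c t).1 - 3 * (1 - (c t).1) * ((c t).2.sin * (c t).2.cos))) t := by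
  obtain ⟨γ, rfl, -, hγ⟩ := isSolution_iff.1 hc
  simpa [cover, liftField] using (hasDerivAt_prod_iff.1 (hγ t)).2.sin

theorem hasDerivAt_cos (hc : IsSolution c) (t : ℝ) : HasDerivAt (fun t => (c t).2.cos)
    (-(c t).2.sin * (-(c t).1 - 3 * (1 - (c t).1) * ((c t).2.sin * (c t).2.cos))) t := by
  obtain ⟨γ, rfl, -, hγ⟩ := isSolution_iff.1 hc
  simpa [cover, liftField] using (hasDerivAt_prod_iff.1 (hγ t)).2.cos

end IsSolution

/-- The smooth bounded vector field on the plane obtained from `liftField` by the substitution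
`T = (1 - cos φ) / 2`, which makes `0 ≤ T ≤ 1` automatic. -/
noncomputable def cosField (x : ℝ × ℝ) : ℝ × ℝ :=
  (3 / 4 * Real.sin x.1 * (1 + Real.cos x.1) * Real.sin x.2 ^ 2,
    (liftField ((1 - Real.cos x.1) / 2, x.2)).2)

theorem norm_cosField_le (x : ℝ × ℝ) : ‖cosField x‖ ≤ (4 : NNReal) := by
  have hc : |1 + Real.cos x.1| ≤ 2 := (abs_add_le _ _).trans <| by
    linarith [abs_one (α := ℝ), Real.abs_cos_le_one x.1]
  have hT := Real.cos_mem_Icc x.1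
  have h1 : |Real.sin x.1 * (1 + Real.cos x.1) * Real.sin x.2 ^ 2| ≤ 1 * 2 * 1 := by
    rw [abs_mul, abs_mul, abs_pow, sq_abs]
    gcongr
    exacts [Real.abs_sin_le_one _, Real.sin_sq_le_one _]
  have h2 : |(1 + Real.cos x.1) * (Real.sin x.2 * Real.cos x.2)| ≤ 2 * (1 * 1) := by
    rw [abs_mul, abs_mul]
    gcongr
    exacts [Real.abs_sin_le_one _, Real.abs_cos_le_one _]
  rw [abs_le] at h1 h2
  simp only [cosField, liftField, Prod.norm_def, Real.norm_eq_abs, NNReal.coe_ofNat]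
  refine max_le (abs_le.2 ⟨?_, ?_⟩) (abs_le.2 ⟨?_, ?_⟩) <;> linarith [hT.1, hT.2]

theorem exists_isSolution_family {T₀ : ℝ} (hT₀ : T₀ ∈ Icc (0 : ℝ) 1) :
    ∃ C : ℝ → ℝ → Cyl, (∀ x, IsSolution (C x)) ∧ (∀ x, C x 0 = (T₀, (x : Real.Angle))) ∧
      ∀ t, Continuous fun x => C x t := by
  have hsmooth : ContDiff ℝ 1 cosField := by
    unfold cosField liftField
    fun_prop
  obtain ⟨Φ, hΦ0, hΦ, hcont⟩ := exists_flow_of_norm_le hsmooth norm_cosField_le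
  set p : ℝ × ℝ → ℝ × ℝ := fun y => ((1 - Real.cos y.1) / 2, y.2)
  have hp : Continuous p := by fun_prop
  have hcos : Real.cos (Real.arccos (1 - 2 * T₀)) = 1 - 2 * T₀ :=
    Real.cos_arccos (by linarith [hT₀.2]) (by linarith [hT₀.1])
  refine ⟨fun x t => cover (p (Φ (Real.arccos (1 - 2 * T₀), x) t)), fun x => ?_, fun x => ?_,
    fun t => continuous_cover.comp (hp.comp ((hcont t).comp (by fun_prop)))⟩
  · refine isSolution_iff.2 ⟨_, rfl, fun t => ?_, fun t => ?_⟩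
    · have := Real.cos_mem_Icc (Φ (Real.arccos (1 - 2 * T₀), x) t).1
      exact ⟨by simp only [p]; linarith [this.2], by simp only [p]; linarith [this.1]⟩
    · obtain ⟨hφ, hθ⟩ := hasDerivAt_prod_iff.1 (hΦ (Real.arccos (1 - 2 * T₀), x) t)
      refine (((hφ.cos.const_sub 1).div_const 2).congr_deriv ?_).prodMk hθ
      have := Real.sin_sq_add_cos_sq (Φ (Real.arccos (1 - 2 * T₀), x) t).1
      simp only [cosField, p, liftField]
      linear_combination 3 / 8 * (1 + Real.cos (Φ (Real.arccos (1 - 2 * T₀), x) t).1) *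
        Real.sin (Φ (Real.arccos (1 - 2 * T₀), x) t).2 ^ 2 * this
  · simp [hΦ0, p, hcos, cover]

theorem existsUnique_isSolution {p : Cyl} (hp : p ∈ closedState) :
    ∃! c : ℝ → Cyl, IsSolution c ∧ c 0 = p := by
  obtain ⟨T₀, φ⟩ := p
  obtain ⟨θ₀, rfl⟩ := QuotientAddGroup.mk_surjective φ
  obtain ⟨C, hC, h0, -⟩ := exists_isSolution_family hp
  exact ⟨C θ₀, ⟨hC θ₀, h0 θ₀⟩, fun c hc => hc.1.eq_of_eq (hC θ₀) (hc.2.trans (h0 θ₀).symm)⟩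

end Lift

namespace IsSolution

variable {c : ℝ → Cyl}

theorem fst_pos_iff (hc : IsSolution c) (s t : ℝ) : 0 < (c s).1 ↔ 0 < (c t).1 := by
  have := hc.continuous_fst
  have := hc.continuous_sin
  refine pos_iff_of_hasDerivAt (a := fun t => 3 * (1 - (c t).1) ^ 2 * (c t).2.sin ^ 2)
    (by fun_prop) (fun t => (hc.hasDerivAt_fst t).congr_deriv ?_) s t
  ring

theorem fst_lt_one_iff (hc : IsSolution c) (s t : ℝ) : (c s).1 < 1 ↔ (c t).1 < 1 := by
  have := hc.continuous_fst
  have := hc.continuous_sin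
  have key := pos_iff_of_hasDerivAt
    (a := fun t => -3 * (c t).1 * (1 - (c t).1) * (c t).2.sin ^ 2) (by fun_prop)
    (fun t => ((hc.hasDerivAt_fst t).const_sub 1).congr_deriv (by ring)) s t
  simpa only [sub_pos] using key

theorem mem_state_iff (hc : IsSolution c) (s t : ℝ) : c s ∈ state ↔ c t ∈ state :=
  and_congr (hc.fst_pos_iff s t) (hc.fst_lt_one_iff s t)

theorem mem_bottom_iff (hc : IsSolution c) (s t : ℝ) : c s ∈ bottom ↔ c t ∈ bottom := by
  have h (r : ℝ) : c r ∈ bottom ↔ ¬ 0 < (c r).1 := (hc.1 r).1.not_lt_iff_eq.trans eq_comm |>.symm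
  rw [h, h, hc.fst_pos_iff s t]

theorem mem_top_iff (hc : IsSolution c) (s t : ℝ) : c s ∈ top ↔ c t ∈ top := by
  have h (r : ℝ) : c r ∈ top ↔ ¬ (c r).1 < 1 := (hc.1 r).2.not_lt_iff_eq.symm
  rw [h, h, hc.fst_lt_one_iff s t]

theorem monotone_fst (hc : IsSolution c) : Monotone fun t => (c t).1 :=
  monotone_of_hasDerivAt_nonneg hc.hasDerivAt_fst fun t => by
    have := (hc.1 t).1
    positivity

theorem strictMono_fst (hc : IsSolution c) (h : c 0 ∈ state) : StrictMono fun t => (c t).1 := by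
  refine hc.monotone_fst.strictMono_of_injective (.of_lt_imp_ne fun a b hab heq => ?_)
  have hstate (t : ℝ) : c t ∈ state := (hc.mem_state_iff 0 t).1 h
  have hconst : ∀ t ∈ Ioo a b, (c t).1 = (c a).1 := fun t ht =>
    le_antisymm ((hc.monotone_fst ht.2.le).trans heq.ge) (hc.monotone_fst ht.1.le)
  have hsin : ∀ t ∈ Ioo a b, (c t).2.sin = 0 := fun t ht => by
    have hderiv := (hc.hasDerivAt_fst t).unique <|
      (hasDerivAt_const t (c a).1).congr_of_eventuallyEq
        (eventually_of_mem (Ioo_mem_nhds ht.1 ht.2) hconst)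
    have h0 := (hstate t).1.ne'
    have h1 := (sub_pos.2 (hstate t).2).ne'
    simpa [h0, h1] using hderiv
  obtain ⟨t, ht⟩ := nonempty_Ioo.2 hab
  have hderiv := (hc.hasDerivAt_sin t).unique <| (hasDerivAt_const t 0).congr_of_eventuallyEq
    (eventually_of_mem (Ioo_mem_nhds ht.1 ht.2) hsin)
  have hcos : (c t).2.cos = 0 := by simpa [hsin t ht, (hstate t).1.ne'] using hderiv
  simpa [hcos, hsin t ht] using (c t).2.cos_sq_add_sin_sq

end IsSolution

section Limits

theorem eq_of_mapClusterPt_of_tendsto {α X : Type*} [TopologicalSpace X] [T2Space X]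
    {l : Filter α} {f : α → X} {x y : X} (hy : MapClusterPt y l f) (hx : Tendsto f l (𝓝 x)) :
    y = x :=
  @eq_of_nhds_neBot _ _ _ _ _ (ClusterPt.mono hy hx)

theorem setOf_mapClusterPt_eq_singleton_iff {α X : Type*} [TopologicalSpace X] [T2Space X]
    {l : Filter α} [l.NeBot] {K : Set X} (hK : IsCompact K) {f : α → X} (hf : ∀ᶠ a in l, f a ∈ K)
    {x : X} : {y | MapClusterPt y l f} = {x} ↔ Tendsto f l (𝓝 x) :=
  ⟨fun h => hK.tendsto_nhds_of_unique_mapClusterPt hf fun _ _ hy => h.subset hy,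
    fun h => eq_singleton_iff_unique_mem.2
      ⟨h.mapClusterPt, fun _ hy => eq_of_mapClusterPt_of_tendsto hy h⟩⟩

theorem eq_zero_of_tendsto_deriv_atBot {f f' : ℝ → ℝ} {l L : ℝ}
    (hf : ∀ t, HasDerivAt f (f' t) t) (hl : Tendsto f atBot (𝓝 l))
    (hL : Tendsto f' atBot (𝓝 L)) : L = 0 := by
  have slope (t : ℝ) : ∃ ξ ∈ Ioo (t - 1) t, f' ξ = (f t - f (t - 1)) / (t - (t - 1)) :=
    exists_hasDerivAt_eq_slope f f' (by linarith)
      (continuous_iff_continuousAt.2 fun t => (hf t).continuousAt).continuousOn fun t _ => hf t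
  choose ξ hξ hslope using slope
  have hξ_lim : Tendsto ξ atBot atBot := tendsto_atBot_mono (fun t => (hξ t).2.le) tendsto_id
  have hdiff := hl.sub (hl.comp (tendsto_atBot_add_const_right atBot (-1) tendsto_id))
  refine tendsto_nhds_unique (hL.comp hξ_lim) ?_
  simpa [Function.comp_def, hslope, ← sub_eq_add_neg] using hdiff

theorem le_of_hasDerivAt_le_neg_mul {f f' a : ℝ → ℝ} {s t : ℝ} (ha : Continuous a)
    (ha0 : ∀ r ∈ Icc s t, 0 ≤ a r) (hf : ∀ r, HasDerivAt f (f' r) r)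
    (hle : ∀ r ∈ Icc s t, f' r ≤ -a r * f r) (hst : s ≤ t) (h0 : 0 ≤ f t) : f t ≤ f s := by
  have hprod (r : ℝ) : HasDerivAt (fun r => f r * Real.exp (∫ x in s..r, a x))
      (f' r * Real.exp (∫ x in s..r, a x) + f r * (Real.exp (∫ x in s..r, a x) * a r)) r :=
    (hf r).fun_mul (ha.integral_hasStrictDerivAt s r).hasDerivAt.exp
  have hanti : AntitoneOn (fun r => f r * Real.exp (∫ x in s..r, a x)) (Icc s t) := by
    refine antitoneOn_of_hasDerivWithinAt_nonpos (convex_Icc s t)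
      (fun r _ => (hprod r).continuousAt.continuousWithinAt)
      (fun r _ => (hprod r).hasDerivWithinAt) fun r hr => ?_
    have := mul_le_mul_of_nonneg_right (hle r (interior_subset hr))
      (Real.exp_pos (∫ x in s..r, a x)).le
    linarith
  calc f t ≤ f t * Real.exp (∫ x in s..t, a x) :=
        le_mul_of_one_le_right h0 <| Real.one_le_exp <| intervalIntegral.integral_nonneg hst ha0
    _ ≤ f s := by simpa using hanti (left_mem_Icc.2 hst) (right_mem_Icc.2 hst) hst

theorem nonpos_of_mul_le_deriv_of_le {f f' : ℝ → ℝ} {a b M : ℝ} (ha : 0 < a)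
    (hf : ∀ x > b, HasDerivAt f (f' x) x) (hle : ∀ x > b, a * f x ≤ f' x)
    (hM : ∀ x > b, f x ≤ M) {x : ℝ} (hx : b < x) : f x ≤ 0 := by
  have hprod : ∀ y > b, HasDerivAt (fun y => f y * Real.exp (-a * y))
      (f' y * Real.exp (-a * y) + f y * (Real.exp (-a * y) * (-a * 1))) y := fun y hy =>
    (hf y hy).fun_mul ((hasDerivAt_id y).const_mul (-a)).exp
  have hmono : MonotoneOn (fun y => f y * Real.exp (-a * y)) (Ioi b) := by
    refine monotoneOn_of_hasDerivWithinAt_nonneg (convex_Ioi b)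
      (fun y hy => (hprod y hy).continuousAt.continuousWithinAt)
      (fun y hy => (hprod y (interior_subset hy)).hasDerivWithinAt) fun y hy => ?_
    have := mul_le_mul_of_nonneg_right (hle y (interior_subset hy)) (Real.exp_pos (-a * y)).le
    linarith
  have hlim : Tendsto (fun y => M * Real.exp (-a * y)) atTop (𝓝 (M * 0)) :=
    (Real.tendsto_exp_atBot.comp
      (tendsto_id.const_mul_atTop_of_neg (neg_neg_of_pos ha))).const_mul M
  have hbound : f x * Real.exp (-a * x) ≤ M * 0 := by
    refine ge_of_tendsto hlim ?_
    filter_upwards [eventually_ge_atTop x] with y hy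
    exact (hmono hx (hx.trans_le hy) hy).trans
      (mul_le_mul_of_nonneg_right (hM y (hx.trans_le hy)) (Real.exp_pos _).le)
  exact nonpos_of_mul_nonpos_left (by simpa using hbound) (Real.exp_pos _)

end Limits

section Angle

instance : CompactSpace Real.Angle :=
  haveI : Fact (0 < 2 * Real.pi) := ⟨Real.two_pi_pos⟩
  inferInstanceAs (CompactSpace (AddCircle (2 * Real.pi)))

theorem comap_nhds_eq_of_preimage_eq_singleton {X Y : Type*} [TopologicalSpace X] [CompactSpace X]
    [TopologicalSpace Y] [T2Space Y] {f : X → Y} (hf : Continuous f) {x : X} {y : Y}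
    (h : f ⁻¹' {y} = {x}) : comap f (𝓝 y) = 𝓝 x := by
  rw [hf.isClosedMap.comap_nhds_eq hf, h, nhdsSet_singleton]

theorem angle_ext {θ ψ : Real.Angle} (hcos : θ.cos = ψ.cos) (hsin : θ.sin = ψ.sin) : θ = ψ := by
  induction θ using Real.Angle.induction_on
  induction ψ using Real.Angle.induction_on
  exact Real.Angle.cos_sin_inj hcos hsin

theorem abs_angle_sin_le_one (θ : Real.Angle) : |θ.sin| ≤ 1 :=
  (sq_le_one_iff_abs_le_one _).1 (by linarith [θ.cos_sq_add_sin_sq, sq_nonneg θ.cos])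

theorem abs_angle_cos_le_one (θ : Real.Angle) : |θ.cos| ≤ 1 :=
  (sq_le_one_iff_abs_le_one _).1 (by linarith [θ.cos_sq_add_sin_sq, sq_nonneg θ.sin])

theorem angle_sin_eq_one_iff {θ : Real.Angle} :
    θ.sin = 1 ↔ θ = ((Real.pi / 2 : ℝ) : Real.Angle) := by
  refine ⟨fun h => angle_ext ?_ (by simp [h]), fun h => by simp [h]⟩
  have := θ.cos_sq_add_sin_sq
  simpa [h] using this

theorem angle_cos_eq_one_iff {θ : Real.Angle} : θ.cos = 1 ↔ θ = ((0 : ℝ) : Real.Angle) := by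
  refine ⟨fun h => angle_ext (by simp [h]) ?_, fun h => by simp [h]⟩
  have := θ.cos_sq_add_sin_sq
  simpa [h] using this

theorem comap_sin_nhds_one : comap Real.Angle.sin (𝓝 1) = 𝓝 ((Real.pi / 2 : ℝ) : Real.Angle) :=
  comap_nhds_eq_of_preimage_eq_singleton Real.Angle.continuous_sin
    (ext fun _ => angle_sin_eq_one_iff)

theorem comap_cos_nhds_one : comap Real.Angle.cos (𝓝 1) = 𝓝 ((0 : ℝ) : Real.Angle) :=
  comap_nhds_eq_of_preimage_eq_singleton Real.Angle.continuous_cos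
    (ext fun _ => angle_cos_eq_one_iff)

end Angle

section TransitTime

theorem deriv_sin_mul_cos_le {x s k m : ℝ} (hm : 0 < m) (hmx : m ≤ x) (hx1 : x ≤ 1)
    (hsk : k ^ 2 + s ^ 2 = 1) :
    (k ^ 2 - s ^ 2) * (-x - 3 * (1 - x) * (s * k)) ≤ -(m / 2) + (9 / (2 * m) + 5) * s ^ 2 := by
  have hcross : -3 * (1 - x) * (s * k) ≤ m / 2 + 9 / (2 * m) * s ^ 2 := by
    have hsq : ((1 - x) * (s * k)) ^ 2 ≤ s ^ 2 := by
      have hk : k ^ 2 ≤ 1 := by linarith [sq_nonneg s]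
      calc ((1 - x) * (s * k)) ^ 2 = (1 - x) ^ 2 * (s ^ 2 * k ^ 2) := by ring
        _ ≤ 1 * (s ^ 2 * 1) := by
          gcongr
          exact pow_le_one₀ (by linarith) (by linarith)
        _ = s ^ 2 := by ring
    calc -3 * (1 - x) * (s * k)
        = m / 2 + 9 / (2 * m) * ((1 - x) * (s * k)) ^ 2
          - (m + 3 * ((1 - x) * (s * k))) ^ 2 / (2 * m) := by field_simp; ring
      _ ≤ m / 2 + 9 / (2 * m) * ((1 - x) * (s * k)) ^ 2 := sub_le_self _ (by positivity)
      _ ≤ m / 2 + 9 / (2 * m) * s ^ 2 := by gcongr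
  have hcubic : s ^ 2 * ((1 - x) * (2 * (s * k))) ≤ s ^ 2 * (1 * 1) := by
    have h2 : 2 * (s * k) ≤ 1 := by linarith [sq_nonneg (s - k)]
    refine mul_le_mul_of_nonneg_left ?_ (sq_nonneg s)
    linarith [mul_le_mul_of_nonneg_left h2 (sub_nonneg.2 hx1)]
  have hlin : s ^ 2 * x ≤ s ^ 2 * 1 := by gcongr
  rw [eq_sub_of_add_eq hsk]
  linarith

theorem exists_transit_time_le {m M : ℝ} (hm : 0 < m) (hM : M < 1) :
    ∃ K, ∀ c, IsSolution c → ∀ a b, a ≤ b → m ≤ (c a).1 → (c b).1 ≤ M → b - a ≤ K := by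
  set B := 9 / (2 * m) + 5
  set A := B / (3 * m * (1 - M) ^ 2)
  have := sub_pos.2 hM
  have : 0 ≤ A := by positivity
  refine ⟨2 / m * (1 + A), fun c hc a b hab ha hb => ?_⟩
  -- For small `sin θ` the first summand decreases at rate about `T`; for larger `sin θ` the
  -- growth of `T` makes up for its possible increase.
  set F : ℝ → ℝ := fun t => (c t).2.sin * (c t).2.cos - A * (c t).1
  have hF (t : ℝ) := ((hc.hasDerivAt_sin t).fun_mul (hc.hasDerivAt_cos t)).fun_sub
    ((hc.hasDerivAt_fst t).const_mul A)
  have hdecay : ∀ t ∈ interior (Icc a b), deriv F t ≤ -(m / 2) := fun t ht => by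
    rw [interior_Icc] at ht
    have hmt : m ≤ (c t).1 := ha.trans (hc.monotone_fst ht.1.le)
    have htM : (c t).1 ≤ M := (hc.monotone_fst ht.2.le).trans hb
    have hx : 0 ≤ (c t).1 := hm.le.trans hmt
    have hAB : B ≤ A * (3 * (c t).1 * (1 - (c t).1) ^ 2) := by
      rw [div_mul_eq_mul_div, le_div_iff₀ (by positivity)]
      gcongr
    have hsin := mul_le_mul_of_nonneg_right hAB (sq_nonneg (c t).2.sin)
    have hprod := deriv_sin_mul_cos_le hm hmt (hc.1 t).2 (c t).2.cos_sq_add_sin_sq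
    rw [(hF t).deriv]
    linarith
  have key := (convex_Icc a b).image_sub_le_mul_sub_of_deriv_le
    (fun t _ => (hF t).continuousAt.continuousWithinAt)
    (fun t _ => (hF t).differentiableAt.differentiableWithinAt) hdecay
    a (left_mem_Icc.2 hab) b (right_mem_Icc.2 hab) hab
  have hbound (t : ℝ) : |(c t).2.sin * (c t).2.cos| ≤ 1 / 2 := by
    have := (c t).2.cos_sq_add_sin_sq
    exact abs_le.2 ⟨by nlinarith [sq_nonneg ((c t).2.sin + (c t).2.cos)],
      by nlinarith [sq_nonneg ((c t).2.sin - (c t).2.cos)]⟩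
  have hT : A * ((c b).1 - (c a).1) ≤ A * 1 := by
    gcongr
    linarith [(hc.1 b).2, (hc.1 a).1]
  rw [div_mul_eq_mul_div, le_div_iff₀ hm]
  linarith [abs_le.1 (hbound a), abs_le.1 (hbound b)]

end TransitTime

namespace IsSolution

variable {c : ℝ → Cyl}

theorem tendsto_fst_atTop (hc : IsSolution c) (h0 : 0 < (c 0).1) :
    Tendsto (fun t => (c t).1) atTop (𝓝 1) := by
  refine tendsto_order.2 ⟨fun M hM => ?_, fun b hb => .of_forall fun t => (hc.1 t).2.trans_lt hb⟩
  obtain ⟨K, hK⟩ := exists_transit_time_le h0 hM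
  filter_upwards [eventually_ge_atTop 0, eventually_gt_atTop K] with t ht htK
  by_contra! hle
  linarith [hK c hc 0 t ht le_rfl hle]

theorem tendsto_fst_atBot (hc : IsSolution c) (h1 : (c 0).1 < 1) :
    Tendsto (fun t => (c t).1) atBot (𝓝 0) := by
  refine tendsto_order.2 ⟨fun b hb => .of_forall fun t => hb.trans_le (hc.1 t).1, fun m hm => ?_⟩
  obtain ⟨K, hK⟩ := exists_transit_time_le hm h1
  filter_upwards [eventually_le_atBot 0, eventually_lt_atBot (-K)] with t ht htK
  by_contra! hle
  linarith [hK c hc t 0 ht hle le_rfl]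

end IsSolution

section FixedPointNeighbourhoods

variable {α : Type*} {l : Filter α} {c : α → Cyl}

theorem tendsto_MPlus_iff : Tendsto c l (𝓝 MPlus) ↔
    Tendsto (fun t => (c t).1) l (𝓝 0) ∧ Tendsto (fun t => (c t).2.sin) l (𝓝 1) := by
  rw [MPlus, nhds_prod_eq, tendsto_prod_iff', ← comap_sin_nhds_one, tendsto_comap_iff]
  rfl

theorem tendsto_dSPlus_iff : Tendsto c l (𝓝 dSPlus) ↔
    Tendsto (fun t => (c t).1) l (𝓝 0) ∧ Tendsto (fun t => (c t).2.cos) l (𝓝 1) := by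
  rw [dSPlus, nhds_prod_eq, tendsto_prod_iff', ← comap_cos_nhds_one, tendsto_comap_iff]
  rfl

theorem halfTurn_halfTurn (p : Cyl) : halfTurn (halfTurn p) = p := by
  simp [halfTurn, add_assoc]

theorem continuous_halfTurn : Continuous halfTurn := by
  unfold halfTurn
  fun_prop

theorem halfTurn_MPlus : halfTurn MPlus = MMinus := by
  simp only [halfTurn, MPlus, MMinus, Prod.mk.injEq, true_and]
  exact Real.Angle.angle_eq_iff_two_pi_dvd_sub.2 ⟨1, by push_cast; ring⟩

theorem halfTurn_dSPlus : halfTurn dSPlus = dSMinus := by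
  simp [halfTurn, dSPlus, dSMinus]

theorem tendsto_halfTurn_comm {p : Cyl} :
    Tendsto (fun t => halfTurn (c t)) l (𝓝 p) ↔ Tendsto c l (𝓝 (halfTurn p)) := by
  refine ⟨fun h => ?_, fun h => ?_⟩
  · simpa only [Function.comp_def, halfTurn_halfTurn] using (continuous_halfTurn.tendsto p).comp h
  · simpa only [Function.comp_def, halfTurn_halfTurn] using
      (continuous_halfTurn.tendsto (halfTurn p)).comp h

end FixedPointNeighbourhoods

section Barrier

/-- The reciprocal `T / (1 - T)` of the Hubble function in units of the scalar field mass. -/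
noncomputable def invHubble (p : Cyl) : ℝ := p.1 / (1 - p.1)

/-- The function `sin θ - T / (3 (1 - T))`. The region where it is positive is invariant backwards
in time, and it increases there backwards in time; this separates the orbits that originate from
`MPlus` from all others. -/
noncomputable def barrier (p : Cyl) : ℝ := p.2.sin - invHubble p / 3

theorem continuousAt_invHubble {p : Cyl} (hp : p.1 < 1) : ContinuousAt invHubble p :=
  continuousAt_fst.div (by fun_prop) (sub_pos.2 hp).ne'

theorem continuousAt_barrier {p : Cyl} (hp : p.1 < 1) : ContinuousAt barrier p :=
  (Real.Angle.continuous_sin.continuousAt.comp continuousAt_snd).sub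
    ((continuousAt_invHubble hp).div_const 3)

theorem barrier_halfTurn (p : Cyl) : barrier (halfTurn p) = -p.2.sin - invHubble p / 3 := by
  simp [barrier, invHubble, halfTurn]

theorem barrier_le_sin {p : Cyl} (h0 : 0 ≤ p.1) (h1 : p.1 ≤ 1) : barrier p ≤ p.2.sin :=
  sub_le_self _ (div_nonneg (div_nonneg h0 (sub_nonneg.2 h1)) zero_le_three)

namespace IsSolution

variable {c : ℝ → Cyl}

theorem hasDerivAt_invHubble (hc : IsSolution c) {t : ℝ} (h1 : (c t).1 < 1) :
    HasDerivAt (fun t => invHubble (c t)) (3 * (c t).1 * (c t).2.sin ^ 2) t := by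
  have hne := (sub_pos.2 h1).ne'
  refine ((hc.hasDerivAt_fst t).fun_div ((hc.hasDerivAt_fst t).const_sub 1) hne).congr_deriv ?_
  field_simp
  ring

theorem hasDerivAt_barrier (hc : IsSolution c) {t : ℝ} (h1 : (c t).1 < 1) :
    HasDerivAt (fun t => barrier (c t))
      (-(3 * (1 - (c t).1) * (c t).2.cos ^ 2) * barrier (c t) - (c t).1 * (1 + (c t).2.cos)) t := by
  have hne := (sub_pos.2 h1).ne'
  refine ((hc.hasDerivAt_sin t).fun_sub ((hc.hasDerivAt_invHubble h1).div_const 3)).congr_deriv ?_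
  rw [← sub_eq_zero, barrier, invHubble]
  field_simp
  linear_combination -(c t).1 * (c t).2.cos_sq_add_sin_sq

theorem barrier_le_of_le (hc : IsSolution c) (h1 : (c 0).1 < 1) {s t : ℝ} (hst : s ≤ t)
    (hb : 0 ≤ barrier (c t)) : barrier (c t) ≤ barrier (c s) := by
  have hlt (r : ℝ) : (c r).1 < 1 := (hc.fst_lt_one_iff 0 r).1 h1
  have hT := hc.continuous_fst
  have hcos := hc.continuous_cos
  refine le_of_hasDerivAt_le_neg_mul (f := fun r => barrier (c r))
    (a := fun r => 3 * (1 - (c r).1) * (c r).2.cos ^ 2) (by fun_prop)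
    (fun r _ => ?_) (fun r => hc.hasDerivAt_barrier (hlt r)) (fun r _ => sub_le_self _ ?_) hst hb
  · have := sub_pos.2 (hlt r)
    positivity
  · exact mul_nonneg (hc.1 r).1 (by linarith [neg_le_of_abs_le (abs_angle_cos_le_one (c r).2)])

theorem tendsto_invHubble_atBot (hc : IsSolution c) (h1 : (c 0).1 < 1) :
    Tendsto (fun t => invHubble (c t)) atBot (𝓝 0) := by
  have hT := hc.tendsto_fst_atBot h1
  simpa [invHubble, Pi.div_def] using hT.div (hT.const_sub 1) (by norm_num)

theorem exists_tendsto_sin_atBot (hc : IsSolution c) (h1 : (c 0).1 < 1) {t : ℝ}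
    (hb : 0 < barrier (c t)) :
    ∃ l, 0 < l ∧ Tendsto (fun t => (c t).2.sin) atBot (𝓝 l) := by
  have hmin (r : ℝ) : 0 ≤ barrier (c (min r t)) :=
    hb.le.trans (hc.barrier_le_of_le h1 (min_le_right r t) hb.le)
  have hanti : Antitone fun r => barrier (c (min r t)) := fun r s hrs =>
    hc.barrier_le_of_le h1 (min_le_min_right t hrs) (hmin s)
  have hbdd : BddAbove (range fun r => barrier (c (min r t))) :=
    ⟨1, forall_mem_range.2 fun r =>
      (barrier_le_sin (hc.1 _).1 (hc.1 _).2).trans (le_of_abs_le (abs_angle_sin_le_one _))⟩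
  refine ⟨⨆ r, barrier (c (min r t)), ?_, ?_⟩
  · exact hb.trans_le ((le_ciSup hbdd t).trans_eq' (by simp))
  · have hlim := (tendsto_atBot_ciSup hanti hbdd).add
      ((hc.tendsto_invHubble_atBot h1).div_const 3)
    rw [zero_div, add_zero] at hlim
    refine hlim.congr' ?_
    filter_upwards [eventually_le_atBot t] with r hr
    rw [min_eq_left hr, barrier, sub_add_cancel]

theorem tendsto_MPlus_of_barrier_pos (hc : IsSolution c) (h1 : (c 0).1 < 1) {t : ℝ}
    (hb : 0 < barrier (c t)) : Tendsto c atBot (𝓝 MPlus) := by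
  obtain ⟨l, hl0, hl⟩ := hc.exists_tendsto_sin_atBot h1 hb
  have hT := hc.tendsto_fst_atBot h1
  have hTcos : Tendsto (fun t => (c t).1 * (c t).2.cos) atBot (𝓝 0) := by
    refine squeeze_zero_norm (fun t => ?_) hT
    rw [norm_mul, Real.norm_of_nonneg (hc.1 t).1]
    exact mul_le_of_le_one_right (hc.1 t).1 (abs_angle_cos_le_one _)
  have hderiv := (hTcos.neg.sub (((hT.const_sub 1).const_mul 3).mul
    (hl.mul ((hl.pow 2).const_sub 1)))).congr' <| .of_forall fun t => show _ =
      (c t).2.cos * (-(c t).1 - 3 * (1 - (c t).1) * ((c t).2.sin * (c t).2.cos)) by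
    rw [← (c t).2.cos_sq_add_sin_sq]
    ring
  have key := eq_zero_of_tendsto_deriv_atBot hc.hasDerivAt_sin hl hderiv
  have hl1 : 1 - l ^ 2 = 0 := by simpa [hl0.ne'] using key
  rw [show l = 1 by nlinarith] at hl
  exact tendsto_MPlus_iff.2 ⟨hT, hl⟩

end IsSolution

theorem isSource_MPlus : IsSource MPlus := by
  refine ⟨⟨by simp [closedState, MPlus], by simp [field_eq, MPlus]⟩, fun V hV => ?_⟩
  have hV' : V ∈ comap (fun p : Cyl => (p.1, p.2.sin)) (𝓝 (0, 1)) := by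
    have hlim := tendsto_comap (f := fun p : Cyl => (p.1, p.2.sin)) (x := 𝓝 (0, 1))
    exact tendsto_MPlus_iff.2 ⟨hlim.fst_nhds, hlim.snd_nhds⟩ hV
  obtain ⟨ε, hε0, hε⟩ := (Metric.nhds_basis_ball.comap _).mem_iff.1 hV'
  have hU : ∀ᶠ p in 𝓝 MPlus, p.1 < min ε 1 ∧ max (1 - ε) 0 < barrier p := by
    refine (continuousAt_fst.eventually_lt_const ?_).and
      ((continuousAt_barrier ?_).eventually_const_lt ?_)
    · simp [MPlus, hε0]
    · simp [MPlus]
    · simp [MPlus, barrier, invHubble, hε0]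
  refine ⟨_, hU, fun c hc h0 => ?_⟩
  obtain ⟨hT, hb⟩ := h0
  rw [lt_min_iff] at hT
  rw [max_lt_iff] at hb
  refine ⟨fun t ht => hε ?_, hc.tendsto_MPlus_of_barrier_pos hT.2 hb.2⟩
  have hsin := (hc.barrier_le_of_le hT.2 ht hb.2.le).trans (barrier_le_sin (hc.1 t).1 (hc.1 t).2)
  have hTt : (c t).1 ≤ (c 0).1 := hc.monotone_fst ht
  rw [mem_preimage, Metric.mem_ball, Prod.dist_eq, max_lt_iff, Real.dist_eq, Real.dist_eq,
    abs_lt, abs_lt]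
  have := (hc.1 t).1
  have := le_of_abs_le (abs_angle_sin_le_one (c t).2)
  refine ⟨⟨?_, ?_⟩, ?_, ?_⟩ <;> dsimp only <;> linarith

end Barrier

section AlphaLimits

/-- The part `|sin θ| ≤ T / (3 (1 - T))` of the cylinder, in which a solution stays for all times
if it does not originate from `MPlus` or `MMinus`. -/
def slowRollRegion : Set Cyl := {p | |p.2.sin| ≤ invHubble p / 3}

theorem mem_slowRollRegion_iff {p : Cyl} :
    p ∈ slowRollRegion ↔ barrier p ≤ 0 ∧ barrier (halfTurn p) ≤ 0 := by
  rw [barrier_halfTurn, barrier, slowRollRegion, mem_ofPred_eq, abs_le']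
  exact and_congr sub_nonpos.symm sub_nonpos.symm

namespace IsSolution

variable {c : ℝ → Cyl}

theorem tendsto_M_or_forall_mem_slowRollRegion (hc : IsSolution c) (h1 : (c 0).1 < 1) :
    Tendsto c atBot (𝓝 MPlus) ∨ Tendsto c atBot (𝓝 MMinus) ∨ ∀ t, c t ∈ slowRollRegion := by
  by_contra! h
  obtain ⟨hplus, hminus, t, ht⟩ := h
  refine ht (mem_slowRollRegion_iff.2 ⟨?_, ?_⟩) <;> by_contra! hb
  · exact hplus (hc.tendsto_MPlus_of_barrier_pos h1 hb)
  · rw [← halfTurn_MPlus, ← tendsto_halfTurn_comm] at hminus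
    exact hminus (hc.halfTurn.tendsto_MPlus_of_barrier_pos h1 hb)

theorem tendsto_dS_of_forall_mem_slowRollRegion (hc : IsSolution c) (h1 : (c 0).1 < 1)
    (hslow : ∀ t, c t ∈ slowRollRegion) :
    Tendsto c atBot (𝓝 dSPlus) ∨ Tendsto c atBot (𝓝 dSMinus) := by
  have hT := hc.tendsto_fst_atBot h1
  have hsin : Tendsto (fun t => (c t).2.sin) atBot (𝓝 0) :=
    squeeze_zero_norm hslow (by simpa using (hc.tendsto_invHubble_atBot h1).div_const 3)
  have hsqrt : Tendsto (fun t => √(1 - (c t).2.sin ^ 2)) atBot (𝓝 1) := by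
    simpa using ((hsin.pow 2).const_sub 1).sqrt
  obtain ⟨t₀, ht₀⟩ := eventually_atBot.1 (hsin.eventually (eventually_abs_sub_lt 0 one_pos))
  have hsq (t : ℝ) : (c t).2.cos ^ 2 = √(1 - (c t).2.sin ^ 2) ^ 2 := by
    have := (c t).2.cos_sq_add_sin_sq
    rw [Real.sq_sqrt (by linarith [sq_nonneg (c t).2.cos])]
    linarith
  have hcont : Continuous fun t => √(1 - (c t).2.sin ^ 2) :=
    (continuous_const.sub (hc.continuous_sin.pow 2)).sqrt
  have hsqrt_pos {t : ℝ} (ht : t ≤ t₀) : 0 < √(1 - (c t).2.sin ^ 2) := by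
    have := ht₀ t ht
    rw [sub_zero, ← sq_lt_one_iff_abs_lt_one] at this
    exact Real.sqrt_pos.2 (sub_pos.2 this)
  rcases isPreconnected_Iic.eq_or_eq_neg_of_sq_eq (S := Iic t₀) hc.continuous_cos.continuousOn
    hcont.continuousOn (fun t _ => hsq t) (fun {t} ht => (hsqrt_pos ht).ne')
    with heq | heq
  · refine .inl (tendsto_dSPlus_iff.2 ⟨hT, hsqrt.congr' ?_⟩)
    filter_upwards [eventually_le_atBot t₀] with t ht using (heq ht).symm
  · refine .inr ?_
    rw [← halfTurn_dSPlus, ← tendsto_halfTurn_comm]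
    refine tendsto_dSPlus_iff.2 ⟨hT, hsqrt.congr' ?_⟩
    filter_upwards [eventually_le_atBot t₀] with t ht
    have hcos : (c t).2.cos = -√(1 - (c t).2.sin ^ 2) := heq ht
    simp [ScalarFieldFLRW.halfTurn, hcos]

theorem tendsto_MPlus_of_mem_bottom (hc : IsSolution c) (h0 : c 0 ∈ bottom)
    (hsin : 0 < (c 0).2.sin) : Tendsto c atBot (𝓝 MPlus) := by
  have hT : (c 0).1 = 0 := h0
  refine hc.tendsto_MPlus_of_barrier_pos (t := 0) (by simp [hT]) ?_
  simpa [barrier, invHubble, hT] using hsin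

theorem tendsto_MMinus_of_mem_bottom (hc : IsSolution c) (h0 : c 0 ∈ bottom)
    (hsin : (c 0).2.sin < 0) : Tendsto c atBot (𝓝 MMinus) := by
  rw [← halfTurn_MPlus, ← tendsto_halfTurn_comm]
  exact hc.halfTurn.tendsto_MPlus_of_mem_bottom h0 (by simpa [ScalarFieldFLRW.halfTurn] using hsin)

end IsSolution

theorem field_halfTurn (p : Cyl) : field (halfTurn p) = field p := by
  simp [field_eq, halfTurn]

theorem isFixedPoint_halfTurn {p : Cyl} (hp : IsFixedPoint p) : IsFixedPoint (halfTurn p) :=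
  ⟨hp.1, (field_halfTurn p).trans hp.2⟩

theorem isSource_halfTurn {p : Cyl} (hp : IsSource p) : IsSource (halfTurn p) := by
  refine ⟨isFixedPoint_halfTurn hp.1, fun V hV => ?_⟩
  obtain ⟨U, hU, h⟩ := hp.2 (halfTurn ⁻¹' V) (continuous_halfTurn.continuousAt hV)
  refine ⟨halfTurn ⁻¹' U, continuous_halfTurn.continuousAt (by rwa [halfTurn_halfTurn]),
    fun c hc h0 => ?_⟩
  obtain ⟨hstay, hlim⟩ := h _ hc.halfTurn h0
  exact ⟨fun t ht => by simpa only [mem_preimage, halfTurn_halfTurn] using hstay t ht,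
    tendsto_halfTurn_comm.1 hlim⟩

end AlphaLimits

section AttractorExistence

theorem MPlus_ne_MMinus : MPlus ≠ MMinus := fun h => by
  have := congrArg (fun p : Cyl => p.2.sin) (halfTurn_MPlus.trans h.symm)
  norm_num [halfTurn, MPlus] at this

theorem isOpen_setOf_exists_barrier_pos {X : Type*} [TopologicalSpace X] {C : X → ℝ → Cyl}
    (hC : ∀ t, Continuous fun x => C x t) (h1 : ∀ x t, (C x t).1 < 1) :
    IsOpen {x | ∃ t, 0 < barrier (C x t)} :=
  isOpen_iff_eventually.2 fun x ⟨t, ht⟩ =>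
    have hcont : ContinuousAt (fun y => barrier (C y t)) x :=
      (continuousAt_barrier (h1 x t)).comp (f := fun y => C y t) (hC t).continuousAt
    (hcont.eventually_const_lt ht).mono fun _ hy => ⟨t, hy⟩

theorem exists_forall_mem_slowRollRegion :
    ∃ c, IsSolution c ∧ c 0 ∈ state ∧ ∀ t, c t ∈ slowRollRegion := by
  obtain ⟨C, hC, hC0, hcont⟩ := exists_isSolution_family (T₀ := 1 / 2) (by norm_num)
  have hstate (x : ℝ) : C x 0 ∈ state := by norm_num [hC0, state]
  have h1 (x t : ℝ) : (C x t).1 < 1 := ((hC x).fst_lt_one_iff 0 t).1 (hstate x).2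
  by_contra! hnone
  have hcover : ∀ x, (∃ t, 0 < barrier (C x t)) ∨ ∃ t, 0 < barrier (halfTurn (C x t)) := by
    intro x
    obtain ⟨t, ht⟩ := hnone (C x) (hC x) (hstate x)
    rw [mem_slowRollRegion_iff, not_and_or, not_le, not_le] at ht
    exact ht.imp (fun h => ⟨t, h⟩) fun h => ⟨t, h⟩
  obtain ⟨x, -, ⟨s, hs⟩, t, ht⟩ := isPreconnected_univ _ _
    (isOpen_setOf_exists_barrier_pos hcont h1)
    (isOpen_setOf_exists_barrier_pos (C := fun x t => halfTurn (C x t))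
      (fun t => continuous_halfTurn.comp (hcont t)) h1)
    (fun x _ => hcover x)
    ⟨Real.pi / 2, mem_univ _, 0, by norm_num [hC0, barrier, invHubble]⟩
    ⟨-(Real.pi / 2), mem_univ _, 0, by norm_num [hC0, barrier, invHubble, halfTurn]⟩
  refine MPlus_ne_MMinus (tendsto_nhds_unique
    ((hC x).tendsto_MPlus_of_barrier_pos (h1 x 0) hs) ?_)
  rw [← halfTurn_MPlus, ← tendsto_halfTurn_comm]
  exact (hC x).halfTurn.tendsto_MPlus_of_barrier_pos (h1 x 0) ht

theorem exists_isSolution_tendsto_dSPlus :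
    ∃ c, IsSolution c ∧ c 0 ∈ state ∧ Tendsto c atBot (𝓝 dSPlus) := by
  obtain ⟨c, hc, h0, hslow⟩ := exists_forall_mem_slowRollRegion
  rcases hc.tendsto_dS_of_forall_mem_slowRollRegion h0.2 hslow with h | h
  · exact ⟨c, hc, h0, h⟩
  · rw [← halfTurn_dSPlus, ← tendsto_halfTurn_comm] at h
    exact ⟨_, hc.halfTurn, h0, h⟩

end AttractorExistence

section AttractorUniqueness

/-- The value of the scalar field, in units in which the Hubble function is
`√(fieldValue² + fieldVelocity²)`. -/
noncomputable def fieldValue (p : Cyl) : ℝ := p.2.cos / invHubble p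

/-- The velocity of the scalar field, in the units of `fieldValue`. -/
noncomputable def fieldVelocity (p : Cyl) : ℝ := p.2.sin / invHubble p

/-- The right-hand side of the Klein–Gordon equation, written as a first order equation for the
velocity `y` of the scalar field as a function of its value `x`. -/
noncomputable def phaseSlope (x y : ℝ) : ℝ := -x / y - 3 * √(x ^ 2 + y ^ 2)

theorem invHubble_pos {p : Cyl} (hp : p ∈ state) : 0 < invHubble p :=
  div_pos hp.1 (sub_pos.2 hp.2)

theorem sqrt_fieldValue_sq_add_fieldVelocity_sq {p : Cyl} (hp : p ∈ state) :
    √(fieldValue p ^ 2 + fieldVelocity p ^ 2) = (invHubble p)⁻¹ := by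
  rw [← Real.sqrt_sq (inv_pos.2 (invHubble_pos hp)).le, fieldValue, fieldVelocity, div_pow,
    div_pow, ← add_div, Real.Angle.cos_sq_add_sin_sq, one_div, inv_pow]

theorem eq_of_fieldValue_eq_of_fieldVelocity_eq {p q : Cyl} (hp : p ∈ state) (hq : q ∈ state)
    (hvalue : fieldValue p = fieldValue q) (hvel : fieldVelocity p = fieldVelocity q) : p = q := by
  have hu : invHubble p = invHubble q := inv_injective <| by
    rw [← sqrt_fieldValue_sq_add_fieldVelocity_sq hp, hvalue, hvel,
      sqrt_fieldValue_sq_add_fieldVelocity_sq hq]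
  have hne := (invHubble_pos hq).ne'
  refine Prod.ext ?_ (angle_ext ?_ ?_)
  · rw [invHubble, invHubble, div_eq_div_iff (sub_pos.2 hp.2).ne' (sub_pos.2 hq.2).ne'] at hu
    linarith
  · rwa [fieldValue, fieldValue, hu, div_left_inj' hne] at hvalue
  · rwa [fieldVelocity, fieldVelocity, hu, div_left_inj' hne] at hvel

theorem mul_sq_sub_le_mul_phaseSlope_sub {x y z : ℝ} (hx : 0 ≤ x) (hy : y ∈ Ico (-1 / 3) 0)
    (hz : z ∈ Ico (-1 / 3) 0) :
    9 * x * (y - z) ^ 2 ≤ (y - z) * (phaseSlope x y - phaseSlope x z) := by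
  have hyz : 0 < y * z := mul_pos_of_neg_of_neg hy.2 hz.2
  have hyz' : y * z ≤ 1 / 9 := by nlinarith [hy.1, hy.2, hz.1, hz.2]
  have hsqrt : 0 ≤ (z - y) * (√(x ^ 2 + y ^ 2) - √(x ^ 2 + z ^ 2)) := by
    rcases le_total y z with h | h
    · exact mul_nonneg (sub_nonneg.2 h) (sub_nonneg.2 (Real.sqrt_le_sqrt (by nlinarith [hz.2])))
    · exact mul_nonneg_of_nonpos_of_nonpos (sub_nonpos.2 h)
        (sub_nonpos.2 (Real.sqrt_le_sqrt (by nlinarith [hy.2])))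
  calc 9 * x * (y - z) ^ 2 ≤ (y * z)⁻¹ * x * (y - z) ^ 2 := by
        gcongr
        exact (le_inv_comm₀ (by norm_num) hyz).2 (by linarith)
    _ ≤ (y * z)⁻¹ * x * (y - z) ^ 2 + 3 * ((z - y) * (√(x ^ 2 + y ^ 2) - √(x ^ 2 + z ^ 2))) := by
        linarith
    _ = (y - z) * (phaseSlope x y - phaseSlope x z) := by
        have := hy.2.ne
        have := hz.2.ne
        rw [phaseSlope, phaseSlope]
        field_simp
        ring

theorem eq_of_hasDerivAt_phaseSlope {P Q : ℝ → ℝ} {x₀ : ℝ} (hx₀ : 1 ≤ x₀)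
    (hP : ∀ x > x₀, HasDerivAt P (phaseSlope x (P x)) x) (hPmem : ∀ x > x₀, P x ∈ Ico (-1 / 3) 0)
    (hQ : ∀ x > x₀, HasDerivAt Q (phaseSlope x (Q x)) x) (hQmem : ∀ x > x₀, Q x ∈ Ico (-1 / 3) 0)
    {x : ℝ} (hx : x₀ < x) : P x = Q x := by
  have hderiv : ∀ x > x₀, HasDerivAt (fun x => (P x - Q x) ^ 2)
      (2 * ((P x - Q x) * (phaseSlope x (P x) - phaseSlope x (Q x)))) x := fun x hx =>
    (((hP x hx).fun_sub (hQ x hx)).fun_pow 2).congr_deriv (by ring)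
  have hsq : (P x - Q x) ^ 2 ≤ 0 := by
    refine nonpos_of_mul_le_deriv_of_le (a := 18) (M := 1) (by norm_num) hderiv
      (fun x hx => ?_) (fun x hx => ?_) hx
    · have := mul_sq_sub_le_mul_phaseSlope_sub (by linarith) (hPmem x hx) (hQmem x hx)
      nlinarith [mul_nonneg (by linarith : 0 ≤ x - 1) (sq_nonneg (P x - Q x))]
    · rw [sq_le_one_iff_abs_le_one, abs_le]
      constructor <;> linarith [(hPmem x hx).1, (hPmem x hx).2, (hQmem x hx).1, (hQmem x hx).2]
  exact sub_eq_zero.1 (pow_eq_zero_iff two_ne_zero |>.1 (le_antisymm hsq (sq_nonneg _)))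

theorem exists_hasDerivAt_leftInverse {f f' : ℝ → ℝ} {t₀ : ℝ}
    (hf : ∀ t ≤ t₀, HasDerivAt f (f' t) t) (hneg : ∀ t ≤ t₀, f' t < 0)
    (hlim : Tendsto f atBot atTop) :
    ∃ g : ℝ → ℝ, ∀ x > f t₀, g x < t₀ ∧ f (g x) = x ∧ HasDerivAt g (f' (g x))⁻¹ x := by
  have hcont : ContinuousOn f (Iic t₀) := fun t ht => (hf t ht).continuousAt.continuousWithinAt
  have hanti : StrictAntiOn f (Iic t₀) :=
    strictAntiOn_of_deriv_neg (convex_Iic t₀) hcont fun t ht => by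
      have ht' : t ∈ Iic t₀ := interior_subset ht
      rw [(hf t ht').deriv]
      exact hneg t ht'
  have hsurj : ∀ x, f t₀ < x → ∃ t < t₀, f t = x := fun x hx => by
    obtain ⟨s, hs, hst⟩ := ((hlim.eventually_ge_atTop x).and (eventually_le_atBot t₀)).exists
    obtain ⟨t, ht, rfl⟩ := intermediate_value_Icc' hst
      (hcont.mono Icc_subset_Iic_self) ⟨hx.le, hs⟩
    exact ⟨t, ht.2.lt_of_ne fun h => hx.ne' (h ▸ rfl), rfl⟩
  choose! g hg hfg using hsurj
  have hmono : MonotoneOn (fun x => -g x) (Ioi (f t₀)) := fun x hx y hy hxy => by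
    rwa [neg_le_neg_iff, ← hanti.le_iff_ge (hg x hx).le (hg y hy).le, hfg x hx, hfg y hy]
  have himage : Ioi (-t₀) ⊆ (fun x => -g x) '' Ioi (f t₀) := fun t ht => by
    have ht' : -t < t₀ := neg_lt.1 ht
    have hft : f t₀ < f (-t) := hanti ht'.le self_mem_Iic ht'
    exact ⟨f (-t), hft, neg_eq_iff_eq_neg.2 (hanti.injOn (hg _ hft).le ht'.le (hfg _ hft))⟩
  refine ⟨g, fun x hx => ⟨hg x hx, hfg x hx, ?_⟩⟩
  have hgcont : ContinuousAt g x := by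
    simpa only [neg_neg] using (continuousAt_of_monotoneOn_of_image_mem_nhds hmono
      (Ioi_mem_nhds hx) (mem_of_superset (Ioi_mem_nhds (neg_lt_neg (hg x hx))) himage)).fun_neg
  exact (hf _ (hg x hx).le).of_local_left_inverse hgcont (hneg _ (hg x hx).le).ne
    ((eventually_gt_nhds hx).mono hfg)

namespace IsSolution

variable {c d : ℝ → Cyl}

theorem hasDerivAt_fieldValue (hc : IsSolution c) {t : ℝ} (ht : c t ∈ state) :
    HasDerivAt (fun t => fieldValue (c t)) ((c t).1 * fieldVelocity (c t)) t := by
  have hu := (invHubble_pos ht).ne'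
  refine ((hc.hasDerivAt_cos t).fun_div (hc.hasDerivAt_invHubble ht.2) hu).congr_deriv ?_
  have hT : (c t).1 = invHubble (c t) * (1 - (c t).1) :=
    (div_mul_cancel₀ _ (sub_pos.2 ht.2).ne').symm
  rw [fieldVelocity, div_eq_iff (pow_ne_zero 2 hu)]
  field_simp
  linear_combination -3 * (c t).2.sin ^ 2 * (c t).2.cos * hT

theorem hasDerivAt_fieldVelocity (hc : IsSolution c) {t : ℝ} (ht : c t ∈ state)
    (hsin : (c t).2.sin ≠ 0) :
    HasDerivAt (fun t => fieldVelocity (c t))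
      ((c t).1 * fieldVelocity (c t) * phaseSlope (fieldValue (c t)) (fieldVelocity (c t))) t := by
  have hu := (invHubble_pos ht).ne'
  refine ((hc.hasDerivAt_sin t).fun_div (hc.hasDerivAt_invHubble ht.2) hu).congr_deriv ?_
  have hT : (c t).1 = invHubble (c t) * (1 - (c t).1) :=
    (div_mul_cancel₀ _ (sub_pos.2 ht.2).ne').symm
  rw [phaseSlope, sqrt_fieldValue_sq_add_fieldVelocity_sq ht, fieldVelocity, fieldValue,
    div_eq_iff (pow_ne_zero 2 hu)]
  field_simp
  linear_combination 3 * (c t).2.sin * (c t).2.cos ^ 2 * hT -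
    3 * (c t).1 * (c t).2.sin * (c t).2.cos_sq_add_sin_sq

theorem forall_mem_slowRollRegion_of_tendsto_dSPlus (hc : IsSolution c) (h1 : (c 0).1 < 1)
    (hlim : Tendsto c atBot (𝓝 dSPlus)) (t : ℝ) : c t ∈ slowRollRegion := by
  rcases hc.tendsto_M_or_forall_mem_slowRollRegion h1 with h | h | h
  · have := congrArg (·.2.sin) (tendsto_nhds_unique h hlim)
    simp [MPlus, dSPlus] at this
  · have := congrArg (·.2.sin) (tendsto_nhds_unique h hlim)
    simp [MMinus, dSPlus, neg_div] at this
  · exact h t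

theorem eventually_sin_neg_of_tendsto_dSPlus (hc : IsSolution c) (h0 : c 0 ∈ state)
    (hlim : Tendsto c atBot (𝓝 dSPlus)) : ∀ᶠ t in atBot, (c t).2.sin < 0 := by
  have hstate (t : ℝ) : c t ∈ state := (hc.mem_state_iff 0 t).1 h0
  have hsin : Tendsto (fun t => (c t).2.sin) atBot (𝓝 0) := by
    simpa [dSPlus, Function.comp_def] using
      ((Real.Angle.continuous_sin.comp continuous_snd).tendsto dSPlus).comp hlim
  obtain ⟨t₀, hcos⟩ := eventually_atBot.1
    ((tendsto_dSPlus_iff.1 hlim).2.eventually_const_lt one_pos)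
  have hnonpos : ∀ t ≤ t₀, (c t).2.sin ≤ 0 := fun t ht => by
    by_contra! hpos
    refine hpos.not_ge (ge_of_tendsto hsin ?_)
    filter_upwards [eventually_le_atBot t] with s hs
    have hT := hc.continuous_fst
    have hcosc := hc.continuous_cos
    refine le_of_hasDerivAt_le_neg_mul (f := fun r => (c r).2.sin)
      (a := fun r => 3 * (1 - (c r).1) * (c r).2.cos ^ 2) (by fun_prop) (fun r _ => ?_)
      hc.hasDerivAt_sin (fun r hr => ?_) hs hpos.le
    · have := sub_pos.2 (hstate r).2
      positivity
    · linarith [mul_pos (hstate r).1 (hcos r (hr.2.trans ht))]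
  filter_upwards [eventually_lt_atBot t₀] with t ht
  refine (hnonpos t ht.le).lt_of_ne fun hzero => ?_
  have hmax : IsLocalMax (fun r => (c r).2.sin) t := by
    filter_upwards [Iio_mem_nhds ht] with r hr using (hnonpos r hr.le).trans_eq hzero.symm
  have hderiv := hmax.hasDerivAt_eq_zero (hc.hasDerivAt_sin t)
  rw [hzero] at hderiv
  linarith [mul_pos (hstate t).1 (hcos t ht.le)]

theorem tendsto_fieldValue_atTop (hc : IsSolution c) (h0 : c 0 ∈ state)
    (hlim : Tendsto c atBot (𝓝 dSPlus)) :
    Tendsto (fun t => fieldValue (c t)) atBot atTop := by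
  have hu : Tendsto (fun t => invHubble (c t)) atBot (𝓝[>] 0) :=
    tendsto_nhdsWithin_iff.2 ⟨hc.tendsto_invHubble_atBot h0.2,
      .of_forall fun t => invHubble_pos ((hc.mem_state_iff 0 t).1 h0)⟩
  exact (tendsto_dSPlus_iff.1 hlim).2.pos_mul_atTop one_pos hu.inv_tendsto_nhdsGT_zero

theorem exists_graph_of_tendsto_dSPlus (hc : IsSolution c) (h0 : c 0 ∈ state)
    (hlim : Tendsto c atBot (𝓝 dSPlus)) :
    ∃ (P : ℝ → ℝ) (x₀ : ℝ), ∀ x > x₀, P x ∈ Ico (-1 / 3) 0 ∧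
      HasDerivAt P (phaseSlope x (P x)) x ∧
      ∃ t, fieldValue (c t) = x ∧ fieldVelocity (c t) = P x := by
  have hstate (t : ℝ) : c t ∈ state := (hc.mem_state_iff 0 t).1 h0
  obtain ⟨t₀, hsin⟩ := eventually_atBot.1 (hc.eventually_sin_neg_of_tendsto_dSPlus h0 hlim)
  have hvel : ∀ t ≤ t₀, fieldVelocity (c t) < 0 := fun t ht =>
    div_neg_of_neg_of_pos (hsin t ht) (invHubble_pos (hstate t))
  have hspeed : ∀ t ≤ t₀, (c t).1 * fieldVelocity (c t) < 0 := fun t ht =>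
    mul_neg_of_pos_of_neg (hstate t).1 (hvel t ht)
  obtain ⟨g, hg⟩ := exists_hasDerivAt_leftInverse
    (fun t _ => hc.hasDerivAt_fieldValue (hstate t)) hspeed (hc.tendsto_fieldValue_atTop h0 hlim)
  refine ⟨fun x => fieldVelocity (c (g x)), fieldValue (c t₀), fun x hx => ?_⟩
  obtain ⟨hgx, hvalue, hderiv⟩ := hg x hx
  refine ⟨⟨?_, hvel _ hgx.le⟩, ?_, g x, hvalue, rfl⟩
  · have hslow := hc.forall_mem_slowRollRegion_of_tendsto_dSPlus h0.2 hlim (g x)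
    rw [slowRollRegion, mem_ofPred_eq] at hslow
    refine (le_div_iff₀ (invHubble_pos (hstate _))).2 ?_
    linarith [neg_le_of_abs_le hslow]
  · have := (hc.hasDerivAt_fieldVelocity (hstate _) (hsin _ hgx.le).ne).comp x hderiv
    rwa [mul_right_comm, mul_inv_cancel₀ (hspeed _ hgx.le).ne, one_mul, hvalue] at this

theorem range_eq_of_tendsto_dSPlus (hc : IsSolution c) (hc0 : c 0 ∈ state)
    (hclim : Tendsto c atBot (𝓝 dSPlus)) (hd : IsSolution d) (hd0 : d 0 ∈ state)
    (hdlim : Tendsto d atBot (𝓝 dSPlus)) : range c = range d := by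
  obtain ⟨P, x₁, hP⟩ := hc.exists_graph_of_tendsto_dSPlus hc0 hclim
  obtain ⟨Q, x₂, hQ⟩ := hd.exists_graph_of_tendsto_dSPlus hd0 hdlim
  obtain ⟨x₀, hx₀⟩ := ((eventually_ge_atTop (1 : ℝ)).and
    ((eventually_ge_atTop x₁).and (eventually_ge_atTop x₂))).exists
  replace hP := fun x (hx : x > x₀) => hP x (hx₀.2.1.trans_lt hx)
  replace hQ := fun x (hx : x > x₀) => hQ x (hx₀.2.2.trans_lt hx)
  have heq : P (x₀ + 1) = Q (x₀ + 1) :=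
    eq_of_hasDerivAt_phaseSlope hx₀.1 (fun x hx => (hP x hx).2.1) (fun x hx => (hP x hx).1)
      (fun x hx => (hQ x hx).2.1) (fun x hx => (hQ x hx).1) (lt_add_one x₀)
  obtain ⟨s, hsvalue, hsvel⟩ := (hP _ (lt_add_one x₀)).2.2
  obtain ⟨t, htvalue, htvel⟩ := (hQ _ (lt_add_one x₀)).2.2
  exact hc.range_eq_of_eq hd (s := s) (t := t) <| eq_of_fieldValue_eq_of_fieldVelocity_eq
    ((hc.mem_state_iff 0 s).1 hc0) ((hd.mem_state_iff 0 t).1 hd0)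
    (hsvalue.trans htvalue.symm) (hsvel.trans (heq.trans htvel.symm))

end IsSolution

end AttractorUniqueness

section Attractors

theorem isCompact_closedState : IsCompact closedState := by
  have : closedState = Icc (0 : ℝ) 1 ×ˢ univ := by
    ext p
    simp [closedState]
  rw [this]
  exact isCompact_Icc.prod isCompact_univ

namespace IsSolution

variable {c : ℝ → Cyl}

theorem alphaSet_eq_singleton_iff (hc : IsSolution c) {p : Cyl} :
    alphaSet c = {p} ↔ Tendsto c atBot (𝓝 p) :=
  setOf_mapClusterPt_eq_singleton_iff isCompact_closedState (.of_forall hc.1)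

theorem omegaSet_eq_singleton_iff (hc : IsSolution c) {p : Cyl} :
    omegaSet c = {p} ↔ Tendsto c atTop (𝓝 p) :=
  setOf_mapClusterPt_eq_singleton_iff isCompact_closedState (.of_forall hc.1)

end IsSolution

theorem originatesFrom_iff {p : Cyl} {O : Set Cyl} : OriginatesFrom p O ↔
    ∃ c, IsSolution c ∧ c 0 ∈ state ∧ range c = O ∧ Tendsto c atBot (𝓝 p) := by
  constructor
  · rintro ⟨hO, c, hc, rfl, hα⟩
    exact ⟨c, hc, hO ⟨0, rfl⟩, rfl, hc.alphaSet_eq_singleton_iff.1 hα⟩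
  · rintro ⟨c, hc, h0, rfl, hlim⟩
    exact ⟨range_subset_iff.2 fun t => (hc.mem_state_iff 0 t).1 h0, c, hc, rfl,
      hc.alphaSet_eq_singleton_iff.2 hlim⟩

theorem involutive_image_halfTurn : Function.Involutive (image halfTurn) :=
  Function.LeftInverse.image_image halfTurn_halfTurn

theorem originatesFrom_image_halfTurn {p : Cyl} {O : Set Cyl} (h : OriginatesFrom p O) :
    OriginatesFrom (halfTurn p) (halfTurn '' O) := by
  obtain ⟨c, hc, h0, rfl, hlim⟩ := originatesFrom_iff.1 h
  exact originatesFrom_iff.2 ⟨_, hc.halfTurn, h0, range_comp halfTurn c,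
    tendsto_halfTurn_comm.2 (by rwa [halfTurn_halfTurn])⟩

theorem originatesFrom_halfTurn_iff {p : Cyl} {O : Set Cyl} :
    OriginatesFrom (halfTurn p) O ↔ OriginatesFrom p (halfTurn '' O) := by
  refine ⟨fun h => ?_, fun h => ?_⟩
  · simpa only [halfTurn_halfTurn] using originatesFrom_image_halfTurn h
  · simpa only [involutive_image_halfTurn O] using originatesFrom_image_halfTurn h

theorem existsUnique_originatesFrom_dSPlus : ∃! O, OriginatesFrom dSPlus O := by
  obtain ⟨a, ha, ha0, halim⟩ := exists_isSolution_tendsto_dSPlus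
  refine ⟨range a, originatesFrom_iff.2 ⟨a, ha, ha0, rfl, halim⟩, fun O hO => ?_⟩
  obtain ⟨c, hc, h0, rfl, hlim⟩ := originatesFrom_iff.1 hO
  exact hc.range_eq_of_tendsto_dSPlus h0 hlim ha ha0 halim

theorem exists_attractors :
    ∃ Aplus Aminus : Set Cyl,
      (∀ O, OriginatesFrom dSPlus O ↔ O = Aplus) ∧
      (∀ O, OriginatesFrom dSMinus O ↔ O = Aminus) ∧
      Aminus = halfTurn '' Aplus ∧
      ∀ c, IsSolution c → c 0 ∈ state → range c ≠ Aplus → range c ≠ Aminus →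
        alphaSet c = {MPlus} ∨ alphaSet c = {MMinus} := by
  obtain ⟨A, hA, hunique⟩ := existsUnique_originatesFrom_dSPlus
  have hplus (O : Set Cyl) : OriginatesFrom dSPlus O ↔ O = A := ⟨hunique O, fun h => h ▸ hA⟩
  have hminus (O : Set Cyl) : OriginatesFrom dSMinus O ↔ O = halfTurn '' A := by
    rw [← halfTurn_dSPlus, originatesFrom_halfTurn_iff, hplus,
      involutive_image_halfTurn.eq_iff]
  refine ⟨A, halfTurn '' A, hplus, hminus, rfl, fun c hc h0 hne hne' => ?_⟩
  rw [hc.alphaSet_eq_singleton_iff, hc.alphaSet_eq_singleton_iff]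
  rcases hc.tendsto_M_or_forall_mem_slowRollRegion h0.2 with h | h | hslow
  · exact .inl h
  · exact .inr h
  · rcases hc.tendsto_dS_of_forall_mem_slowRollRegion h0.2 hslow with h | h
    · exact absurd ((hplus _).1 (originatesFrom_iff.2 ⟨c, hc, h0, rfl, h⟩)) hne
    · exact absurd ((hminus _).1 (originatesFrom_iff.2 ⟨c, hc, h0, rfl, h⟩)) hne'

end Attractors

section OmegaLimits

theorem tendsto_atBot_of_hasDerivAt_le {f f' : ℝ → ℝ} {C : ℝ} (hC : C < 0)
    (hf : ∀ t, HasDerivAt f (f' t) t) (hle : ∀ᶠ t in atTop, f' t ≤ C) :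
    Tendsto f atTop atBot := by
  obtain ⟨a, ha⟩ := eventually_atTop.1 hle
  have hbound : ∀ t ≥ a, f t ≤ f a + C * (t - a) := fun t ht => by
    have := (convex_Ici a).image_sub_le_mul_sub_of_deriv_le
      (fun t _ => (hf t).continuousAt.continuousWithinAt)
      (fun t _ => (hf t).differentiableAt.differentiableWithinAt)
      (fun t ht => (hf t).deriv.trans_le (ha t (interior_subset ht))) a self_mem_Ici t ht ht
    linarith
  refine tendsto_atBot_mono' _ ((eventually_ge_atTop a).mono hbound) ?_
  exact tendsto_atBot_add_const_left _ _
    ((tendsto_atTop_add_const_right _ (-a) tendsto_id).const_mul_atTop_of_neg hC)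

theorem frequently_coe_angle_eq {θ : ℝ → ℝ} (hcont : Continuous θ) (hθ : Tendsto θ atTop atBot)
    (φ : Real.Angle) : ∃ᶠ t in atTop, (θ t : Real.Angle) = φ := by
  induction φ using Real.Angle.induction_on with
  | h x =>
    refine frequently_atTop.2 fun a => ?_
    obtain ⟨n, hn⟩ := exists_nat_ge ((x - θ a) / (2 * Real.pi))
    have hxa : x - n * (2 * Real.pi) ≤ θ a := by
      rw [div_le_iff₀ Real.two_pi_pos] at hn
      linarith
    obtain ⟨b, hb, hab⟩ := ((hθ.eventually_le_atBot (x - n * (2 * Real.pi))).and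
      (eventually_ge_atTop a)).exists
    obtain ⟨t, ht, htx⟩ := intermediate_value_Icc' hab hcont.continuousOn ⟨hb, hxa⟩
    exact ⟨t, ht.1, by simp [htx]⟩

theorem inv_sqrt_one_add_angle_tan_sq {φ : Real.Angle} (hφ : 0 < φ.cos) :
    (√(1 + φ.tan ^ 2))⁻¹ = φ.cos := by
  induction φ using Real.Angle.induction_on with
  | h x => exact Real.Angle.tan_coe x ▸ Real.inv_sqrt_one_add_tan_sq hφ

namespace IsSolution

variable {c : ℝ → Cyl}

theorem frequently_snd_eq (hc : IsSolution c) (h0 : 0 < (c 0).1) (φ : Real.Angle) :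
    ∃ᶠ t in atTop, (c t).2 = φ := by
  obtain ⟨T, θ, hcθ, hderiv⟩ := hc.2
  have hθ (t : ℝ) : (c t).2 = θ t := congrArg Prod.snd (hcθ t)
  simp only [hθ]
  refine frequently_coe_angle_eq
    (continuous_iff_continuousAt.2 fun t => (hderiv t).2.continuousAt)
    (tendsto_atBot_of_hasDerivAt_le (C := -(1 / 2)) (by norm_num) (fun t => (hderiv t).2) ?_) φ
  filter_upwards [(hc.tendsto_fst_atTop h0).eventually_const_lt (by norm_num : (4 / 5 : ℝ) < 1)]
    with t ht
  have hsc : -(1 / 2) ≤ (c t).2.sin * (c t).2.cos := by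
    linarith [sq_nonneg ((c t).2.sin + (c t).2.cos), (c t).2.cos_sq_add_sin_sq]
  have := mul_le_mul_of_nonneg_left hsc (sub_nonneg.2 (hc.1 t).2)
  rw [field_eq]
  linarith

theorem omegaSet_eq_top (hc : IsSolution c) (h0 : 0 < (c 0).1) : omegaSet c = top := by
  have hT := hc.tendsto_fst_atTop h0
  refine Subset.antisymm (fun p hp => ?_) ?_
  · exact eq_of_mapClusterPt_of_tendsto
      (hp.continuousAt_comp continuousAt_fst) hT
  · rintro ⟨x, φ⟩ (rfl : x = 1)
    refine mapClusterPt_iff_frequently.2 fun s hs => ?_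
    have hmem : ∀ᶠ t in atTop, ((c t).1, φ) ∈ s :=
      (hT.prodMk_nhds tendsto_const_nhds).eventually hs
    refine ((hc.frequently_snd_eq h0 φ).and_eventually hmem).mono fun t ⟨hφ, ht⟩ => ?_
    rwa [← hφ] at ht

theorem cos_pos_iff_of_mem_bottom (hc : IsSolution c) (h0 : c 0 ∈ bottom) (s t : ℝ) :
    0 < (c s).2.cos ↔ 0 < (c t).2.cos := by
  have hT (r : ℝ) : (c r).1 = 0 := (hc.mem_bottom_iff 0 r).1 h0
  have hsin := hc.continuous_sin
  refine pos_iff_of_hasDerivAt (f := fun r => (c r).2.cos) (a := fun r => 3 * (c r).2.sin ^ 2)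
    (by fun_prop) (fun r => (hc.hasDerivAt_cos r).congr_deriv ?_) s t
  rw [hT]
  ring

theorem hasDerivAt_tan_of_mem_bottom (hc : IsSolution c) (h0 : c 0 ∈ bottom) {t : ℝ}
    (hcos : (c t).2.cos ≠ 0) : HasDerivAt (fun t => (c t).2.tan) (-3 * (c t).2.tan) t := by
  have hT : (c t).1 = 0 := (hc.mem_bottom_iff 0 t).1 h0
  simp only [Real.Angle.tan_eq_sin_div_cos]
  refine ((hc.hasDerivAt_sin t).fun_div (hc.hasDerivAt_cos t) hcos).congr_deriv ?_
  rw [hT]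
  field_simp
  linear_combination -3 * (c t).2.sin * (c t).2.cos * (c t).2.cos_sq_add_sin_sq

theorem tendsto_dSPlus_of_mem_bottom (hc : IsSolution c) (h0 : c 0 ∈ bottom)
    (hcos : 0 < (c 0).2.cos) : Tendsto c atTop (𝓝 dSPlus) := by
  have hcos_pos (t : ℝ) : 0 < (c t).2.cos := (hc.cos_pos_iff_of_mem_bottom h0 0 t).1 hcos
  have htan (t : ℝ) : (c t).2.tan = (c 0).2.tan * Real.exp (-3 * t) := by
    have := eq_mul_exp_integral_of_hasDerivAt continuous_const
      (fun t => hc.hasDerivAt_tan_of_mem_bottom h0 (hcos_pos t).ne') 0 t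
    rwa [intervalIntegral.integral_const, sub_zero, smul_eq_mul, mul_comm t] at this
  have hlim : Tendsto (fun t => (c t).2.tan) atTop (𝓝 0) := by
    refine Tendsto.congr (fun t => (htan t).symm) ?_
    simpa using (Real.tendsto_exp_atBot.comp
      (tendsto_id.const_mul_atTop_of_neg (by norm_num : (-3 : ℝ) < 0))).const_mul (c 0).2.tan
  have hcos_eq (t : ℝ) : (c t).2.cos = (√(1 + (c t).2.tan ^ 2))⁻¹ :=
    (inv_sqrt_one_add_angle_tan_sq (hcos_pos t)).symm
  refine tendsto_dSPlus_iff.2 ⟨?_, ?_⟩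
  · exact tendsto_const_nhds.congr fun t => ((hc.mem_bottom_iff 0 t).1 h0).symm
  · simp only [hcos_eq]
    simpa using ((hlim.pow 2).const_add 1).sqrt.inv₀ (by simp)

theorem omegaSet_eq_dSPlus_iff (hc : IsSolution c) :
    omegaSet c = {dSPlus} ↔ c 0 ∈ bottom ∧ 0 < (c 0).2.cos := by
  rw [hc.omegaSet_eq_singleton_iff]
  refine ⟨fun h => ?_, fun h => hc.tendsto_dSPlus_of_mem_bottom h.1 h.2⟩
  obtain ⟨hT, hcos⟩ := tendsto_dSPlus_iff.1 h
  have h0 : c 0 ∈ bottom := by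
    refine ((hc.1 0).1.eq_or_lt'.resolve_right fun hpos => ?_)
    exact zero_ne_one (tendsto_nhds_unique hT (hc.tendsto_fst_atTop hpos))
  obtain ⟨t, ht⟩ := (hcos.eventually_const_lt one_pos).exists
  exact ⟨h0, (hc.cos_pos_iff_of_mem_bottom h0 t 0).1 ht⟩

theorem omegaSet_eq_dSMinus_iff (hc : IsSolution c) :
    omegaSet c = {dSMinus} ↔ c 0 ∈ bottom ∧ (c 0).2.cos < 0 := by
  rw [hc.omegaSet_eq_singleton_iff, ← halfTurn_dSPlus, ← tendsto_halfTurn_comm,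
    ← hc.halfTurn.omegaSet_eq_singleton_iff, hc.halfTurn.omegaSet_eq_dSPlus_iff]
  simp [ScalarFieldFLRW.halfTurn, bottom]

theorem frequently_decel_eq (hc : IsSolution c) (h0 : 0 < (c 0).1) (φ : Real.Angle) :
    ∃ᶠ t in atTop, decel (c t) = -1 + 3 * φ.sin ^ 2 :=
  (hc.frequently_snd_eq h0 φ).mono fun t ht => by rw [decel, ht]

theorem decel_oscillates (hc : IsSolution c) (h0 : 0 < (c 0).1) :
    (∃ᶠ t in atTop, decel (c t) = -1) ∧ (∃ᶠ t in atTop, decel (c t) = 2) ∧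
      ¬ ∃ l : ℝ, Tendsto (fun t => decel (c t)) atTop (𝓝 l) := by
  have hmin : ∃ᶠ t in atTop, decel (c t) = -1 := by
    simpa using hc.frequently_decel_eq h0 0
  have hmax : ∃ᶠ t in atTop, decel (c t) = 2 := by
    refine (hc.frequently_decel_eq h0 (Real.pi / 2 : ℝ)).mono fun t ht => ht.trans ?_
    norm_num
  refine ⟨hmin, hmax, fun ⟨l, hl⟩ => ?_⟩
  have hl_min := tendsto_nhds_unique_of_frequently_eq hl tendsto_const_nhds hmin
  have hl_max := tendsto_nhds_unique_of_frequently_eq hl tendsto_const_nhds hmax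
  linarith

end IsSolution

theorem decel_mem_Icc (p : Cyl) : decel p ∈ Icc (-1) 2 := by
  have hsin := p.2.cos_sq_add_sin_sq
  constructor <;> rw [decel] <;> linarith [sq_nonneg p.2.sin, sq_nonneg p.2.cos]

theorem field_top {p : Cyl} (hp : p ∈ top) : field p = (0, -1) := by
  have : p.1 = 1 := hp
  simp [field, this]

theorem isPeriodicOrbit_top : IsPeriodicOrbit top := by
  have hsol : IsSolution fun t => (1, ((-t : ℝ) : Real.Angle)) := by
    refine ⟨fun t => by simp [closedState], fun _ => 1, fun t => -t, fun _ => rfl, fun t => ?_⟩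
    rw [field_top rfl]
    exact ⟨hasDerivAt_const t 1, hasDerivAt_neg t⟩
  refine ⟨_, hsol, Subset.antisymm (range_subset_iff.2 fun _ => rfl) ?_,
    ⟨(1, 0), rfl, (1, (Real.pi : Real.Angle)), rfl, ?_⟩, 2 * Real.pi, Real.two_pi_pos, fun t => ?_⟩
  · rintro ⟨x, φ⟩ (rfl : x = 1)
    induction φ using Real.Angle.induction_on with
    | h y => exact ⟨-y, by simp⟩
  · exact fun h => Real.Angle.pi_ne_zero (congrArg Prod.snd h).symm
  · simp [neg_add_rev]

end OmegaLimits

section FixedPoints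

theorem isFixedPoint_MPlus : IsFixedPoint MPlus :=
  ⟨by simp [closedState, MPlus], by simp [field_eq, MPlus]⟩

theorem isFixedPoint_dSPlus : IsFixedPoint dSPlus :=
  ⟨by simp [closedState, dSPlus], by simp [field_eq, dSPlus]⟩

theorem fst_eq_zero_and_sin_mul_cos_eq_zero_of_field_eq_zero {p : Cyl} (hp : field p = 0) :
    p.1 = 0 ∧ p.2.sin * p.2.cos = 0 := by
  rw [field_eq, Prod.mk_eq_zero] at hp
  obtain ⟨hT, hθ⟩ := hp
  have hT0 : p.1 = 0 := by
    by_contra hne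
    have hT1 : 1 - p.1 ≠ 0 := fun h => by
      rw [h] at hθ
      linarith
    have hsin : p.2.sin = 0 := by simpa [hne, hT1] using hT
    exact hne (by simpa [hsin] using hθ)
  exact ⟨hT0, by simpa [hT0] using hθ⟩

theorem isFixedPoint_iff (p : Cyl) :
    IsFixedPoint p ↔ p = MPlus ∨ p = MMinus ∨ p = dSPlus ∨ p = dSMinus := by
  constructor
  · rintro ⟨-, hp⟩
    obtain ⟨hT, hsc⟩ := fst_eq_zero_and_sin_mul_cos_eq_zero_of_field_eq_zero hp
    simp only [MPlus, MMinus, dSPlus, dSMinus, Prod.ext_iff, hT, true_and]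
    rcases mul_eq_zero.1 hsc with hsin | hcos
    · rcases Real.Angle.sin_eq_zero_iff.1 hsin with h | h <;> simp [h]
    · rcases Real.Angle.cos_eq_zero_iff.1 hcos with h | h <;> simp [h]
  · rintro (rfl | rfl | rfl | rfl)
    · exact isFixedPoint_MPlus
    · exact halfTurn_MPlus ▸ isFixedPoint_halfTurn isFixedPoint_MPlus
    · exact isFixedPoint_dSPlus
    · exact halfTurn_dSPlus ▸ isFixedPoint_halfTurn isFixedPoint_dSPlus

theorem linearization_cover (a : ℝ × ℝ) : linearization (cover a) = fderiv ℝ liftField a := by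
  have hfield : (fun x : ℝ × ℝ => field ((cover a).1 + x.1, (cover a).2 + (x.2 : Real.Angle))) =
      fun x => liftField (a + x) :=
    funext fun x => field_cover (a + x)
  rw [linearization, hfield, fderiv_comp_add_left, add_zero]

theorem hasFDerivAt_liftField_bottom (θ : ℝ) :
    HasFDerivAt liftField
      (((3 * Real.sin θ ^ 2) • ContinuousLinearMap.fst ℝ ℝ ℝ).prod
        ((3 * (Real.sin θ * Real.cos θ) - 1) • ContinuousLinearMap.fst ℝ ℝ ℝ +
          (-3 * (Real.cos θ ^ 2 - Real.sin θ ^ 2)) • ContinuousLinearMap.snd ℝ ℝ ℝ)) (0, θ) := by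
  have hT : HasFDerivAt Prod.fst (ContinuousLinearMap.fst ℝ ℝ ℝ) (0, θ) := hasFDerivAt_fst
  have hθ : HasFDerivAt Prod.snd (ContinuousLinearMap.snd ℝ ℝ ℝ) (0, θ) := hasFDerivAt_snd
  have hT' := hT.const_sub 1
  refine ((((hT.const_mul 3).mul (hT'.pow 2)).mul (hθ.sin.pow 2)).prodMk
    (hT.neg.sub ((hT'.const_mul 3).mul (hθ.sin.mul hθ.cos)))).congr_fderiv ?_
  ext <;> simp <;> ring

theorem linearization_MPlus : linearization MPlus =
    ((3 : ℝ) • ContinuousLinearMap.fst ℝ ℝ ℝ).prod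
      (-ContinuousLinearMap.fst ℝ ℝ ℝ + (3 : ℝ) • ContinuousLinearMap.snd ℝ ℝ ℝ) := by
  rw [show MPlus = cover (0, Real.pi / 2) from rfl, linearization_cover,
    (hasFDerivAt_liftField_bottom _).fderiv]
  ext <;> simp

theorem linearization_dSPlus : linearization dSPlus =
    (0 : (ℝ × ℝ) →L[ℝ] ℝ).prod
      (-ContinuousLinearMap.fst ℝ ℝ ℝ + (-3 : ℝ) • ContinuousLinearMap.snd ℝ ℝ ℝ) := by
  rw [show dSPlus = cover (0, 0) from rfl, linearization_cover,
    (hasFDerivAt_liftField_bottom _).fderiv]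
  ext <;> simp

theorem linearization_halfTurn (p : Cyl) : linearization (halfTurn p) = linearization p := by
  have hfield (x : ℝ × ℝ) : field ((halfTurn p).1 + x.1, (halfTurn p).2 + (x.2 : Real.Angle)) =
      field (p.1 + x.1, p.2 + (x.2 : Real.Angle)) := by
    rw [← field_halfTurn (p.1 + x.1, p.2 + (x.2 : Real.Angle))]
    simp only [halfTurn, add_right_comm]
  simp only [linearization, hfield]

theorem charpoly_of_lowerTriangular {R : Type*} [CommRing R] [Nontrivial R]
    {f : (R × R) →ₗ[R] (R × R)} {r s t : R} (h1 : f (1, 0) = (r, t)) (h2 : f (0, 1) = (0, s)) :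
    f.charpoly = (Polynomial.X - Polynomial.C r) * (Polynomial.X - Polynomial.C s) := by
  have hmatrix : LinearMap.toMatrix (Module.Basis.finTwoProd R) (Module.Basis.finTwoProd R) f =
      !![r, 0; t, s] := by
    ext i j
    fin_cases i <;> fin_cases j <;> simp [LinearMap.toMatrix_apply, h1, h2]
  rw [← LinearMap.charpoly_toMatrix f (Module.Basis.finTwoProd R), hmatrix,
    Matrix.charpoly_fin_two, Matrix.trace_fin_two_of, Matrix.det_fin_two_of]
  simp only [zero_mul, sub_zero, map_add, map_mul]
  ring

theorem eigenvalues_eq_of_lowerTriangular {p : Cyl} {r s t : ℝ}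
    (h1 : linearization p (1, 0) = (r, t)) (h2 : linearization p (0, 1) = (0, s)) :
    eigenvalues p = {(r : ℂ), (s : ℂ)} := by
  rw [eigenvalues, charpoly_of_lowerTriangular h1 h2,
    Polynomial.aroots_mul (mul_ne_zero (Polynomial.X_sub_C_ne_zero r)
      (Polynomial.X_sub_C_ne_zero s)), Polynomial.aroots_X_sub_C, Polynomial.aroots_X_sub_C]
  rfl

theorem eigenvalues_M {p : Cyl} (hp : p = MPlus ∨ p = MMinus) : eigenvalues p = {3, 3} := by
  have hlin : linearization p = linearization MPlus := by
    rcases hp with rfl | rfl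
    · rfl
    · rw [← halfTurn_MPlus, linearization_halfTurn]
  rw [linearization_MPlus] at hlin
  simpa using eigenvalues_eq_of_lowerTriangular (p := p) (r := 3) (s := 3) (t := -1)
    (by simp [hlin]) (by simp [hlin])

theorem linearization_dS {p : Cyl} (hp : p = dSPlus ∨ p = dSMinus) : linearization p =
    (0 : (ℝ × ℝ) →L[ℝ] ℝ).prod
      (-ContinuousLinearMap.fst ℝ ℝ ℝ + (-3 : ℝ) • ContinuousLinearMap.snd ℝ ℝ ℝ) := by
  rcases hp with rfl | rfl
  · exact linearization_dSPlus
  · rw [← halfTurn_dSPlus, linearization_halfTurn, linearization_dSPlus]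

theorem eigenvalues_dS {p : Cyl} (hp : p = dSPlus ∨ p = dSMinus) : eigenvalues p = {-3, 0} := by
  have hlin := linearization_dS hp
  rw [Multiset.pair_comm]
  simpa using eigenvalues_eq_of_lowerTriangular (p := p) (r := 0) (s := -3) (t := -1)
    (by simp [hlin]) (by simp [hlin])

theorem isSource_M {p : Cyl} (hp : p = MPlus ∨ p = MMinus) : IsSource p := by
  rcases hp with rfl | rfl
  · exact isSource_MPlus
  · exact halfTurn_MPlus ▸ isSource_halfTurn isSource_MPlus

theorem isHyperbolic_M {p : Cyl} (hp : p = MPlus ∨ p = MMinus) : IsHyperbolic p := by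
  refine ⟨(isFixedPoint_iff p).2 (hp.imp_right .inl), fun z hz => ?_⟩
  obtain rfl : z = 3 := by simpa [eigenvalues_M hp] using hz
  norm_num

theorem not_isHyperbolic_dS {p : Cyl} (hp : p = dSPlus ∨ p = dSMinus) : ¬ IsHyperbolic p :=
  fun h => h.2 0 (by simp [eigenvalues_dS hp]) rfl

end FixedPoints

end ScalarFieldFLRW

theorem mainTheorem1 :
    -- through every point of the closed cylinder there is exactly one solution, defined for all
    -- times, and the interior and the two boundary circles are invariant
    (∀ p ∈ closedState, ∃! c : ℝ → Cyl, IsSolution c ∧ c 0 = p) ∧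
    (∀ c, IsSolution c → ∀ τ, (c 0 ∈ state ↔ c τ ∈ state) ∧
      (c 0 ∈ bottom ↔ c τ ∈ bottom) ∧ (c 0 ∈ top ↔ c τ ∈ top)) ∧
    -- the discrete symmetry, which exchanges the two points of each pair
    (∀ c, IsSolution c → IsSolution (fun τ => halfTurn (c τ))) ∧
    halfTurn MPlus = MMinus ∧ halfTurn dSPlus = dSMinus ∧
    -- T is strictly increasing along every orbit in the interior
    (∀ c, IsSolution c → c 0 ∈ state → StrictMono (fun τ => (c τ).1)) ∧
    -- the fixed points
    (∀ p, IsFixedPoint p ↔ p = MPlus ∨ p = MMinus ∨ p = dSPlus ∨ p = dSMinus) ∧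
    -- the hyperbolic sources
    (∀ p, p = MPlus ∨ p = MMinus →
      IsHyperbolic p ∧ eigenvalues p = {3, 3} ∧ IsSource p) ∧
    -- the de Sitter points are not hyperbolic; the eigenvalue -3 belongs to the direction of T = 0
    (∀ p, p = dSPlus ∨ p = dSMinus →
      ¬ IsHyperbolic p ∧ eigenvalues p = {-3, 0} ∧ linearization p (0, 1) = (0, -3)) ∧
    -- their stable sets are open arcs of T = 0
    (∀ c, IsSolution c →
      (omegaSet c = {dSPlus} ↔ c 0 ∈ bottom ∧ 0 < (c 0).2.cos) ∧
      (omegaSet c = {dSMinus} ↔ c 0 ∈ bottom ∧ (c 0).2.cos < 0)) ∧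
    -- no orbit in T = 0 other than a de Sitter point itself originates from a de Sitter point
    (∀ c, IsSolution c → c 0 ∈ bottom →
      (0 < (c 0).2.sin → alphaSet c = {MPlus}) ∧ ((c 0).2.sin < 0 → alphaSet c = {MMinus})) ∧
    -- exactly one orbit leaves each de Sitter point into the interior, and all other orbits in the
    -- interior originate from the sources
    (∃ Aplus Aminus : Set Cyl,
      (∀ O, OriginatesFrom dSPlus O ↔ O = Aplus) ∧
      (∀ O, OriginatesFrom dSMinus O ↔ O = Aminus) ∧
      Aminus = halfTurn '' Aplus ∧
      ∀ c, IsSolution c → c 0 ∈ state → range c ≠ Aplus → range c ≠ Aminus →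
        alphaSet c = {MPlus} ∨ alphaSet c = {MMinus}) ∧
    -- the circle T = 1 is a periodic orbit and the ω-limit set of every orbit in the interior
    IsPeriodicOrbit top ∧
    (∀ p ∈ top, field p = (0, -1)) ∧
    (∀ c, IsSolution c → c 0 ∈ state → omegaSet c = top) ∧
    -- q keeps oscillating between -1 and 2 and has no limit
    (∀ c, IsSolution c → c 0 ∈ state →
      (∀ τ, -1 ≤ decel (c τ) ∧ decel (c τ) ≤ 2) ∧
      (∃ᶠ τ in atTop, decel (c τ) = -1) ∧ (∃ᶠ τ in atTop, decel (c τ) = 2) ∧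
      ¬ ∃ l : ℝ, Tendsto (fun τ => decel (c τ)) atTop (𝓝 l)) := by
  refine ⟨fun p hp => existsUnique_isSolution hp,
    fun c hc t => ⟨hc.mem_state_iff 0 t, hc.mem_bottom_iff 0 t, hc.mem_top_iff 0 t⟩,
    fun c hc => hc.halfTurn, halfTurn_MPlus, halfTurn_dSPlus,
    fun c hc h0 => hc.strictMono_fst h0, isFixedPoint_iff,
    fun p hp => ⟨isHyperbolic_M hp, eigenvalues_M hp, isSource_M hp⟩,
    fun p hp => ⟨not_isHyperbolic_dS hp, eigenvalues_dS hp, by simp [linearization_dS hp]⟩,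
    fun c hc => ⟨hc.omegaSet_eq_dSPlus_iff, hc.omegaSet_eq_dSMinus_iff⟩,
    fun c hc h0 =>
      ⟨fun hsin => hc.alphaSet_eq_singleton_iff.2 (hc.tendsto_MPlus_of_mem_bottom h0 hsin),
        fun hsin => hc.alphaSet_eq_singleton_iff.2 (hc.tendsto_MMinus_of_mem_bottom h0 hsin)⟩,
    exists_attractors, isPeriodicOrbit_top, fun p hp => field_top hp,
    fun c hc h0 => hc.omegaSet_eq_top h0.1,
    fun c hc h0 => ⟨fun t => decel_mem_Icc (c t), hc.decel_oscillates h0.1⟩⟩
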